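/- **Corollary (Szegő kernel of the right half-space).** Let $\mathbb O$ be the octonions, $z=x_0+\sum_{i=1}^7x_ie_i$, $\Re z=x_0$. A real differentiable function $f:U\to\mathbb O$ on an open set $U\subseteq\mathbb O$ is left $\mathbb O$-regular if $\mathcal Df=\sum_{i=0}^7e_i\,\partial f/\partial x_i=0$ on $U$ (with $e_0=1$). Let $\Omega$ be the right half-space $H^+(\mathbb O)=\{\Re z>0\}$ or a strip $\mathcal S_d=\{0<\Re z<d\}$, $d>0$. The Hardy space $H^2(\Omega)$ consists of the left $\mathbb O$-regular functions $f$ on $\Omega$ whose $L^2$-norms over the hyperplanes $\{\Re z=s\}\subset\Omega$ are bounded uniformly in $s$ and which have $L^2$ boundary values on $\partial\Omega$ (the restrictions to $\{\Re z=s\}$ converge in $L^2(\mathbb R^7)$ as $s$ tends to $\Re$ of either boundary component). Put $$(f,g)_{\partial\Omega}=\frac3{\pi^4}\int_{\partial\Omega}\overline{g(z)}\,f(z)\,dS(z),$$ where the boundary values are used and $dS$ is the 7-dimensional surface measure. A Szegő kernel of $\Omega$ is a function $S_\Omega:\Omega\times\Omega\to\mathbb O$ such that for every $w\in\Omega$ one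 has $S_\Omega(\cdot,w)\in H^2(\Omega)$ and $f(w)=(f,S_\Omega(\cdot,w))_{\partial\Omega}$ for all $f\in H^2(\Omega)$. Then: 1. The half-space $H^+(\mathbb O)$ has exactly one Szegő kernel, namely $$S_{H^+}(z,w)=\frac{\overline z+w}{|\overline z+w|^8}\qquad(z,w\in H^+(\mathbb O)).$$ 2. For every $d>0$ the strip $\mathcal S_d$ has exactly one Szegő kernel, namely the convergent series $$S_{\mathcal S_d}(z,w)=\sum_{n\in\mathbb Z}(-1)^n\frac{\overline z+w+2dn}{|\overline z+w+2dn|^8}\qquad(z,w\in\mathcal S_d).$$ 3. For all $z,w\in H^+(\mathbb O)$, $\displaystyle S_{H^+}(z,w)=\lim_{d\to\infty}S_{\mathcal S_d}(z,w)$. -/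

import Mathlib

open Real Set Filter Topology MeasureTheory
open scoped ENNReal NNReal

noncomputable section

/-- The octonions as a real Euclidean space: `z i` is the coordinate `x_i` of
`z = x_0 + x_1 e_1 + ... + x_7 e_7`. -/
abbrev Octonion : Type := EuclideanSpace ℝ (Fin 8)

namespace Octonion

/-- The basis octonions `e_0 = 1, e_1, ..., e_7`. -/
def e (i : Fin 8) : Octonion := EuclideanSpace.single i 1

/-- The octonionic product, with `e_4 = e_1 e_2`, `e_5 = e_1 e_3`, `e_6 = e_2 e_3` and
`e_7 = (e_1 e_2) e_3`. -/
instance : Mul Octonion where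
  mul a b := !₂[
    a 0 * b 0 - a 1 * b 1 - a 2 * b 2 - a 3 * b 3 - a 4 * b 4 - a 5 * b 5 - a 6 * b 6 - a 7 * b 7,
    a 0 * b 1 + a 1 * b 0 + a 2 * b 4 + a 3 * b 5 - a 4 * b 2 - a 5 * b 3 - a 6 * b 7 + a 7 * b 6,
    a 0 * b 2 - a 1 * b 4 + a 2 * b 0 + a 3 * b 6 + a 4 * b 1 + a 5 * b 7 - a 6 * b 3 - a 7 * b 5,
    a 0 * b 3 - a 1 * b 5 - a 2 * b 6 + a 3 * b 0 - a 4 * b 7 + a 5 * b 1 + a 6 * b 2 + a 7 * b 4,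
    a 0 * b 4 + a 1 * b 2 - a 2 * b 1 + a 3 * b 7 + a 4 * b 0 - a 5 * b 6 + a 6 * b 5 - a 7 * b 3,
    a 0 * b 5 + a 1 * b 3 - a 2 * b 7 - a 3 * b 1 + a 4 * b 6 + a 5 * b 0 - a 6 * b 4 + a 7 * b 2,
    a 0 * b 6 + a 1 * b 7 + a 2 * b 3 - a 3 * b 2 - a 4 * b 5 + a 5 * b 4 + a 6 * b 0 - a 7 * b 1,
    a 0 * b 7 - a 1 * b 6 + a 2 * b 5 - a 3 * b 4 + a 4 * b 3 - a 5 * b 2 + a 6 * b 1 + a 7 * b 0]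

/-- Octonionic conjugation. -/
def conj (a : Octonion) : Octonion :=
  !₂[a 0, -a 1, -a 2, -a 3, -a 4, -a 5, -a 6, -a 7]

/-- The octonion `t + x_1 e_1 + ... + x_7 e_7`. -/
def point (t : ℝ) (x : EuclideanSpace ℝ (Fin 7)) : Octonion :=
  WithLp.toLp 2 (Fin.cons t x.ofLp)

/-- The octonionic Cauchy-Riemann operator `D f = ∑ e_i (∂f/∂x_i)`, acting from the left. -/
def cauchyRiemann (f : Octonion → Octonion) (z : Octonion) : Octonion :=
  ∑ i : Fin 8, e i * fderiv ℝ f z (e i)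

/-- Left octonionic regularity on an open set `U`. -/
def LeftRegularOn (f : Octonion → Octonion) (U : Set Octonion) : Prop :=
  DifferentiableOn ℝ f U ∧ ∀ z ∈ U, cauchyRiemann f z = 0

/-- The domain `{z | Re z ∈ I}`: the right half-space for `I = Ioi 0`, the strip of
thickness `d` for `I = Ioo 0 d`. -/
def slab (I : Set ℝ) : Set Octonion := {z | z 0 ∈ I}

/-- The scalar surface measure `dS` on the boundary `{z | Re z ∈ frontier I}` of `slab I`: on each
hyperplane `{Re z = t}`, `t ∈ frontier I`, it is 7-dimensional Lebesgue measure. -/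
def surfaceMeasure (I : Set ℝ) : Measure Octonion :=
  Measure.sum fun t : frontier I => (volume : Measure (EuclideanSpace ℝ (Fin 7))).map (point t)

/-- `φ` is (on the boundary of `slab I`) the square-integrable boundary value of `f`: the
restrictions of `f` to the hyperplanes `{Re z = s}` inside the domain converge to `φ` in `L²` as
`s` tends to a boundary point of `I`. -/
def HasBoundaryValue (I : Set ℝ) (f φ : Octonion → Octonion) : Prop :=
  ∀ t ∈ frontier I,
    MemLp (fun x : EuclideanSpace ℝ (Fin 7) => φ (point t x)) 2 volume ∧
    Tendsto (fun s : ℝ =>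
      eLpNorm (fun x : EuclideanSpace ℝ (Fin 7) => f (point s x) - φ (point t x)) 2 volume)
      (𝓝[I] t) (𝓝 0)

/-- The Hardy space `H²` of left regular functions on `slab I`: the `L²` norms over the hyperplanes
`{Re z = s}` in the domain are uniformly bounded, and `f` has an `L²` boundary value. -/
structure MemHardy (I : Set ℝ) (f : Octonion → Octonion) : Prop where
  leftRegularOn : LeftRegularOn f (slab I)
  bounded : ∃ C : ℝ≥0, ∀ s ∈ I,
    eLpNorm (fun x : EuclideanSpace ℝ (Fin 7) => f (point s x)) 2 volume ≤ C
  exists_boundaryValue : ∃ φ : Octonion → Octonion, HasBoundaryValue I f φ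

/-- The octonion-valued Hardy inner product `(φ, ψ) = (3/π⁴) ∫_{∂Ω} conj(ψ) φ dS`, `Ω = slab I`. -/
def hardyInner (I : Set ℝ) (φ ψ : Octonion → Octonion) : Octonion :=
  (3 / π ^ 4) • ∫ z, conj (ψ z) * φ z ∂(surfaceMeasure I)

/-- `K` is a Szegő kernel of `Ω = slab I`: for all `w ∈ Ω` the function `K(·, w)` belongs to the
Hardy space, and `f(w) = (f, K(·, w))` for all `f` in the Hardy space, where the inner product is
taken on boundary values. -/
def IsSzegoKernel (I : Set ℝ) (K : Octonion → Octonion → Octonion) : Prop :=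
  ∀ w ∈ slab I, MemHardy I (fun z => K z w) ∧
    ∀ f : Octonion → Octonion, MemHardy I f →
      ∀ φ κ : Octonion → Octonion,
        HasBoundaryValue I f φ → HasBoundaryValue I (fun z => K z w) κ →
          f w = hardyInner I φ κ

end Octonion

end

noncomputable section

namespace Octonion

/-! The kernels are Cauchy kernels in disguise. On the hyperplane Re z = t one has conj z = 2t - z,
so the conjugate of `cauchyKernel (z + conj w)` is minus the Cauchy kernel with pole w + 2t
(`conj_cauchyKernel_point`). For the half-space t = 0, and the Hardy pairing with the kernel is the
Cauchy integral of f over the boundary, which reproduces f(w) (`MemHardy.cauchy_halfSpace`). For the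
strip, term n has pole w + 2dn on the face Re z = 0 and w + 2d(n+1) on the face Re z = d. Shifting
the index on the second face flips the sign (-1)^n, so the two faces combine into Cauchy integrals
over the whole boundary with poles w + 2dn. Only n = 0 has its pole inside the strip; the other
integrals vanish (`strip_rep`).

The Cauchy formula comes from the divergence theorem for the fields G (e_i f). The product rule
gives G (Df) = 0 plus the sum of (∂_i G)(e_i f). For a radial field G = θ(|u|²) conj u that sum is a
real multiple of f, by the identity conj u (u a) = |u|² a, so associativity is never needed
(`sum_radialFDeriv_mul`). The Cauchy kernel is smoothed near its pole to such a field with an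
explicit compactly supported density of mass π⁴/3; rescaling makes the density an approximate
identity while the boundary integrals stay fixed (`cauchy_formula_of_mem`). Cutoffs remove the sides
at infinity, because the kernel restricted to a slice is dominated by the L² weight `decay`, and L²
convergence carries the formula to the boundary.

For uniqueness, the difference g of two kernels with the same w is orthogonal to itself, since both
kernels reproduce g(w). Its boundary value is thus zero, and the reproducing property at z gives
g(z) = 0 (`IsSzegoKernel.eq`). The limit in d is dominated convergence over n. -/

/-! ### Octonion algebra. -/

theorem mul_def (a b : Octonion) : a * b = !₂[
    a 0 * b 0 - a 1 * b 1 - a 2 * b 2 - a 3 * b 3 - a 4 * b 4 - a 5 * b 5 - a 6 * b 6 - a 7 * b 7,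
    a 0 * b 1 + a 1 * b 0 + a 2 * b 4 + a 3 * b 5 - a 4 * b 2 - a 5 * b 3 - a 6 * b 7 + a 7 * b 6,
    a 0 * b 2 - a 1 * b 4 + a 2 * b 0 + a 3 * b 6 + a 4 * b 1 + a 5 * b 7 - a 6 * b 3 - a 7 * b 5,
    a 0 * b 3 - a 1 * b 5 - a 2 * b 6 + a 3 * b 0 - a 4 * b 7 + a 5 * b 1 + a 6 * b 2 + a 7 * b 4,
    a 0 * b 4 + a 1 * b 2 - a 2 * b 1 + a 3 * b 7 + a 4 * b 0 - a 5 * b 6 + a 6 * b 5 - a 7 * b 3,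
    a 0 * b 5 + a 1 * b 3 - a 2 * b 7 - a 3 * b 1 + a 4 * b 6 + a 5 * b 0 - a 6 * b 4 + a 7 * b 2,
    a 0 * b 6 + a 1 * b 7 + a 2 * b 3 - a 3 * b 2 - a 4 * b 5 + a 5 * b 4 + a 6 * b 0 - a 7 * b 1,
    a 0 * b 7 - a 1 * b 6 + a 2 * b 5 - a 3 * b 4 + a 4 * b 3 - a 5 * b 2 + a 6 * b 1 + a 7 * b 0] :=
  rfl

theorem norm_sq_eq (a : Octonion) : ‖a‖ ^ 2 = a 0 ^ 2 + a 1 ^ 2 + a 2 ^ 2 + a 3 ^ 2 + a 4 ^ 2 +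
    a 5 ^ 2 + a 6 ^ 2 + a 7 ^ 2 := by
  simp [EuclideanSpace.norm_sq_eq, Fin.sum_univ_eight]

/-- After squaring, this is Degen's eight-square identity. -/
protected theorem norm_mul (a b : Octonion) : ‖a * b‖ = ‖a‖ * ‖b‖ := by
  have h : ‖a * b‖ ^ 2 = (‖a‖ * ‖b‖) ^ 2 := by
    rw [mul_pow, norm_sq_eq, norm_sq_eq, norm_sq_eq]
    simp [mul_def]
    ring
  exact (pow_left_inj₀ (norm_nonneg _) (by positivity) two_ne_zero).1 h

/-- Octonionic multiplication as a bilinear map. -/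
def mulₗ : Octonion →ₗ[ℝ] Octonion →ₗ[ℝ] Octonion :=
  LinearMap.mk₂ ℝ (fun a b => a * b)
    (fun a a' b => by ext i; fin_cases i <;> simp [mul_def] <;> ring)
    (fun c a b => by ext i; fin_cases i <;> simp [mul_def] <;> ring)
    (fun a b b' => by ext i; fin_cases i <;> simp [mul_def] <;> ring)
    (fun c a b => by ext i; fin_cases i <;> simp [mul_def] <;> ring)

/-- Octonionic multiplication as a continuous bilinear map. -/
def mulL : Octonion →L[ℝ] Octonion →L[ℝ] Octonion :=
  mulₗ.mkContinuous₂ 1 fun a b => by simp [mulₗ, Octonion.norm_mul]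

theorem mulL_apply (a b : Octonion) : mulL a b = a * b := rfl

/-- Octonionic conjugation as a continuous linear map. -/
def conjL : Octonion →L[ℝ] Octonion :=
  LinearMap.toContinuousLinearMap
    { toFun := conj
      map_add' := fun a b => by ext i; fin_cases i <;> simp [conj] <;> ring
      map_smul' := fun c a => by ext i; fin_cases i <;> simp [conj] }

theorem conjL_apply (a : Octonion) : conjL a = conj a := rfl

protected theorem add_mul (a b c : Octonion) : (a + b) * c = a * c + b * c := by
  simp only [← mulL_apply, map_add, _root_.add_apply]

protected theorem sub_mul (a b c : Octonion) : (a - b) * c = a * c - b * c := by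
  simp only [← mulL_apply, map_sub, _root_.sub_apply]

protected theorem mul_add (a b c : Octonion) : a * (b + c) = a * b + a * c := by
  simp only [← mulL_apply, map_add]

protected theorem mul_sub (a b c : Octonion) : a * (b - c) = a * b - a * c := by
  simp only [← mulL_apply, map_sub]

protected theorem smul_mul (t : ℝ) (a b : Octonion) : (t • a) * b = t • (a * b) := by
  simp only [← mulL_apply, map_smul, _root_.smul_apply]

protected theorem mul_smul (t : ℝ) (a b : Octonion) : a * (t • b) = t • (a * b) := by
  simp only [← mulL_apply, map_smul]

protected theorem neg_mul (a b : Octonion) : (-a) * b = -(a * b) := by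
  simp only [← mulL_apply, map_neg, _root_.neg_apply]

protected theorem mul_zero (a : Octonion) : a * 0 = 0 := by
  simp only [← mulL_apply, map_zero]

theorem conj_add (a b : Octonion) : conj (a + b) = conj a + conj b := map_add conjL a b

theorem conj_sub (a b : Octonion) : conj (a - b) = conj a - conj b := map_sub conjL a b

theorem conj_neg (a : Octonion) : conj (-a) = -conj a := map_neg conjL a

theorem conj_smul (t : ℝ) (a : Octonion) : conj (t • a) = t • conj a := map_smul conjL t a

theorem conj_conj (a : Octonion) : conj (conj a) = a := by
  ext i; fin_cases i <;> simp [conj]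

theorem conj_e_zero : conj (e 0) = e 0 := by
  ext i; fin_cases i <;> simp [conj, e]

theorem norm_conj (a : Octonion) : ‖conj a‖ = ‖a‖ := by
  have h : ‖conj a‖ ^ 2 = ‖a‖ ^ 2 := by
    rw [norm_sq_eq, norm_sq_eq]
    simp [conj]
  exact (pow_left_inj₀ (norm_nonneg _) (norm_nonneg _) two_ne_zero).1 h

/-- This consequence of alternativity is the substitute for associativity in the Cauchy formula. -/
theorem conj_mul_mul (u a : Octonion) : conj u * (u * a) = ‖u‖ ^ 2 • a := by
  ext i
  simp only [PiLp.smul_apply, smul_eq_mul, norm_sq_eq]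
  fin_cases i <;> simp [conj, mul_def] <;> ring

theorem e_zero_mul (a : Octonion) : e 0 * a = a := by
  ext i; fin_cases i <;> simp [e, mul_def]

theorem conj_mul_self (a : Octonion) : conj a * a = ‖a‖ ^ 2 • e 0 := by
  ext i
  simp only [PiLp.smul_apply, smul_eq_mul, norm_sq_eq]
  fin_cases i <;> simp [conj, mul_def, e] <;> ring

theorem mul_conj_self (a : Octonion) : a * conj a = ‖a‖ ^ 2 • e 0 := by
  simpa only [conj_conj, norm_conj] using conj_mul_self (conj a)

theorem sum_conj_e_mul (a : Octonion) : ∑ i, conj (e i) * (e i * a) = (8 : ℝ) • a := by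
  simp only [conj_mul_mul]
  simp [e, ← Nat.cast_smul_eq_nsmul ℝ]

theorem sum_e_mul_conj : ∑ i, e i * conj (e i) = (8 : ℝ) • e 0 := by
  simp only [mul_conj_self]
  simp [e, ← Nat.cast_smul_eq_nsmul ℝ]

theorem sum_smul_e (u : Octonion) : ∑ i, u i • e i = u := by
  ext j
  fin_cases j <;> simp [e, Fin.sum_univ_eight]

/-! ### Real and imaginary parts. -/

theorem norm_sq_point (t : ℝ) (x : EuclideanSpace ℝ (Fin 7)) :
    ‖point t x‖ ^ 2 = t ^ 2 + ‖x‖ ^ 2 := by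
  simp [EuclideanSpace.norm_sq_eq, point, Fin.sum_univ_succ]

/-- The imaginary part of an octonion. -/
def im (z : Octonion) : EuclideanSpace ℝ (Fin 7) := WithLp.toLp 2 (Fin.tail z.ofLp)

theorem point_im (z : Octonion) : point (z 0) (im z) = z := by
  ext i
  refine Fin.cases rfl (fun j => rfl) i

theorem im_point (t : ℝ) (x : EuclideanSpace ℝ (Fin 7)) : im (point t x) = x := rfl

theorem point_add (s t : ℝ) (x y : EuclideanSpace ℝ (Fin 7)) :
    point s x + point t y = point (s + t) (x + y) := by
  ext i
  refine Fin.cases rfl (fun j => rfl) i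

theorem point_sub (s t : ℝ) (x y : EuclideanSpace ℝ (Fin 7)) :
    point s x - point t y = point (s - t) (x - y) := by
  ext i
  refine Fin.cases rfl (fun j => rfl) i

theorem conj_point (t : ℝ) (x : EuclideanSpace ℝ (Fin 7)) : conj (point t x) = point t (-x) := by
  ext i
  fin_cases i <;> rfl

theorem smul_e_zero (t : ℝ) : t • e 0 = point t 0 := by
  ext i
  fin_cases i <;> simp [e, point] <;> rfl

theorem continuous_point : Continuous fun p : ℝ × EuclideanSpace ℝ (Fin 7) => point p.1 p.2 := by
  refine (PiLp.continuous_toLp 2 _).comp (continuous_pi fun i => ?_)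
  refine Fin.cases ?_ (fun j => ?_) i
  · exact continuous_fst
  · simp only [Fin.cons_succ]
    fun_prop

theorem abs_re_le_norm (z : Octonion) : |z 0| ≤ ‖z‖ := PiLp.norm_apply_le z 0

theorem norm_im_le_norm (z : Octonion) : ‖im z‖ ≤ ‖z‖ := by
  have h := norm_sq_point (z 0) (im z)
  rw [point_im] at h
  exact pow_le_pow_iff_left₀ (norm_nonneg _) (norm_nonneg _) two_ne_zero |>.1
    (by rw [h]; nlinarith [sq_nonneg (z 0)])

/-! ### Radial fields and the Cauchy kernel. -/

/-- The derivative at `u` of `θ (‖u‖ ^ 2) • conj u`, where `a = θ (‖u‖ ^ 2)`, `b = θ' (‖u‖ ^ 2)`. -/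
def radialFDeriv (a b : ℝ) (u : Octonion) : Octonion →L[ℝ] Octonion :=
  a • conjL + ((2 * b) • innerSL ℝ u).smulRight (conj u)

theorem radialFDeriv_apply (a b : ℝ) (u v : Octonion) :
    radialFDeriv a b u v = a • conj v + (2 * b * inner ℝ u v) • conj u := by
  simp [radialFDeriv, conjL_apply, mul_assoc]

theorem inner_e (u : Octonion) (i : Fin 8) : inner ℝ u (e i) = u i := by
  simp [e, EuclideanSpace.inner_single_right]

theorem hasFDerivAt_radial {θ : ℝ → ℝ} {b : ℝ} {u : Octonion}
    (h : HasDerivAt θ b (‖u‖ ^ 2)) :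
    HasFDerivAt (fun u : Octonion => θ (‖u‖ ^ 2) • conj u) (radialFDeriv (θ (‖u‖ ^ 2)) b u) u := by
  have h1 : HasFDerivAt (fun u : Octonion => θ (‖u‖ ^ 2)) (b • (2 • innerSL ℝ u)) u :=
    h.comp_hasFDerivAt u (hasStrictFDerivAt_norm_sq u).hasFDerivAt
  refine (h1.smul conjL.hasFDerivAt).congr_fderiv ?_
  ext1 v
  simp only [radialFDeriv_apply]
  simp only [conjL_apply, add_apply, smul_apply, ContinuousLinearMap.smulRight_apply,
    innerSL_apply_apply, smul_eq_mul]
  congr 2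
  simp
  ring

/-- The part of the derivative along conj u produces conj u (u v) = |u|² v, and the part a conj
produces 8 v, one for each basis vector. The factor v stays in place throughout, which is what makes
the divergence of G (e_i f) a scalar multiple of f. -/
theorem sum_radialFDeriv_mul (a b : ℝ) (u v : Octonion) :
    ∑ i, radialFDeriv a b u (e i) * (e i * v) = (8 * a + 2 * ‖u‖ ^ 2 * b) • v := by
  have h : ∑ i, (u i) • (conj u * (e i * v)) = ‖u‖ ^ 2 • v := by
    rw [← conj_mul_mul u v]
    have := congrArg (fun x => mulL (conj u) (mulL x v)) (sum_smul_e u)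
    simp only [map_sum, map_smul, sum_apply, smul_apply] at this
    exact this
  calc _ = a • ∑ i, conj (e i) * (e i * v) + (2 * b) • ∑ i, (u i) • (conj u * (e i * v)) := by
        simp only [radialFDeriv_apply, inner_e, Octonion.add_mul, Octonion.smul_mul,
          Finset.sum_add_distrib, Finset.smul_sum, mul_smul]
    _ = _ := by
        rw [sum_conj_e_mul, h]
        module

theorem sum_mul_radialFDeriv (a b : ℝ) (u : Octonion) :
    ∑ i, e i * radialFDeriv a b u (e i) = (8 * a + 2 * ‖u‖ ^ 2 * b) • e 0 := by
  have h : ∑ i, (u i) • (e i * conj u) = ‖u‖ ^ 2 • e 0 := by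
    rw [← mul_conj_self u]
    have := congrArg (fun x => mulL x (conj u)) (sum_smul_e u)
    simp only [map_sum, map_smul, sum_apply, smul_apply] at this
    exact this
  calc _ = a • ∑ i, e i * conj (e i) + (2 * b) • ∑ i, (u i) • (e i * conj u) := by
        simp only [radialFDeriv_apply, inner_e, Octonion.mul_add, Octonion.mul_smul,
          Finset.sum_add_distrib, Finset.smul_sum, mul_smul]
    _ = _ := by
        rw [sum_e_mul_conj, h]
        module

theorem norm_radialFDeriv_le (a b : ℝ) (u : Octonion) :
    ‖radialFDeriv a b u‖ ≤ |a| + 2 * |b| * ‖u‖ ^ 2 := by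
  refine ContinuousLinearMap.opNorm_le_bound _ (by positivity) fun v => ?_
  rw [radialFDeriv_apply]
  calc _ ≤ ‖a • conj v‖ + ‖(2 * b * inner ℝ u v) • conj u‖ := norm_add_le _ _
    _ = |a| * ‖v‖ + 2 * |b| * |inner ℝ u v| * ‖u‖ := by
        simp [norm_smul, norm_conj]
    _ ≤ |a| * ‖v‖ + 2 * |b| * (‖u‖ * ‖v‖) * ‖u‖ := by
        gcongr
        exact abs_real_inner_le_norm u v
    _ = _ := by ring

/-- The Cauchy kernel `conj u / |u|^8`. -/
def cauchyKernel (u : Octonion) : Octonion := (‖u‖ ^ 8)⁻¹ • conj u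

theorem norm_cauchyKernel (u : Octonion) : ‖cauchyKernel u‖ = (‖u‖ ^ 7)⁻¹ := by
  rw [cauchyKernel, norm_smul, norm_conj, norm_inv, norm_pow, norm_norm]
  rcases eq_or_ne ‖u‖ 0 with h | h
  · simp [h]
  · field_simp

theorem conj_cauchyKernel (u : Octonion) : conj (cauchyKernel u) = (‖u‖ ^ 8)⁻¹ • u := by
  rw [cauchyKernel, conj_smul, conj_conj]

theorem hasFDerivAt_cauchyKernel {u : Octonion} (hu : u ≠ 0) :
    HasFDerivAt cauchyKernel
      (radialFDeriv (‖u‖ ^ 8)⁻¹ (-4 * (‖u‖ ^ 10)⁻¹) u) u := by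
  have hu' : ‖u‖ ≠ 0 := norm_ne_zero_iff.2 hu
  have h : HasDerivAt (fun t : ℝ => (t ^ 4)⁻¹) (-4 * (‖u‖ ^ 10)⁻¹) (‖u‖ ^ 2) := by
    refine ((hasDerivAt_pow 4 (‖u‖ ^ 2)).inv (by positivity)).congr_deriv ?_
    field_simp
    norm_num
    ring
  have := hasFDerivAt_radial h
  simp only [← pow_mul] at this
  exact this

/-- The profile t⁻⁴ solves 8θ + 2tθ' = 0; this fixes the exponent 8 in the kernel. -/
theorem sum_mul_fderiv_cauchyKernel {u : Octonion} (hu : u ≠ 0) :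
    ∑ i, e i * radialFDeriv (‖u‖ ^ 8)⁻¹ (-4 * (‖u‖ ^ 10)⁻¹) u (e i) = 0 := by
  have hu' : ‖u‖ ≠ 0 := norm_ne_zero_iff.2 hu
  rw [sum_mul_radialFDeriv]
  convert zero_smul ℝ (e 0)
  field_simp
  norm_num

theorem norm_fderiv_cauchyKernel_le {u : Octonion} (hu : u ≠ 0) :
    ‖radialFDeriv (‖u‖ ^ 8)⁻¹ (-4 * (‖u‖ ^ 10)⁻¹) u‖ ≤ 9 * (‖u‖ ^ 8)⁻¹ := by
  have hu' : ‖u‖ ≠ 0 := norm_ne_zero_iff.2 hu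
  refine (norm_radialFDeriv_le _ _ _).trans_eq ?_
  rw [abs_mul, abs_inv, abs_inv, abs_of_nonneg (by positivity : 0 ≤ ‖u‖ ^ 8),
    abs_of_nonneg (by positivity : 0 ≤ ‖u‖ ^ 10)]
  norm_num
  field_simp
  norm_num

/-! ### Smoothing the Cauchy kernel at its pole. -/

/-- A continuously differentiable profile that equals `t⁻⁴` for `1 ≤ t` and is affine for
`t ≤ 1`. -/
def profile (t : ℝ) : ℝ := if t ≤ 1 then 5 - 4 * t else (t ^ 4)⁻¹

/-- The derivative of `profile`. -/
def profileDeriv (t : ℝ) : ℝ := if t ≤ 1 then -4 else -4 * (t ^ 5)⁻¹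

theorem profile_of_le {t : ℝ} (h : t ≤ 1) : profile t = 5 - 4 * t := if_pos h

theorem profile_of_ge {t : ℝ} (h : 1 ≤ t) : profile t = (t ^ 4)⁻¹ := by
  rcases h.eq_or_lt with rfl | h
  · norm_num [profile]
  · exact if_neg h.not_ge

theorem profileDeriv_of_le {t : ℝ} (h : t ≤ 1) : profileDeriv t = -4 := if_pos h

theorem profileDeriv_of_ge {t : ℝ} (h : 1 ≤ t) : profileDeriv t = -4 * (t ^ 5)⁻¹ := by
  rcases h.eq_or_lt with rfl | h
  · norm_num [profileDeriv]
  · exact if_neg h.not_ge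

theorem hasDerivWithinAt_profile_Iic {t : ℝ} (h : t ≤ 1) :
    HasDerivWithinAt profile (profileDeriv t) (Iic 1) t := by
  have h1 : HasDerivAt (fun t : ℝ => 5 - 4 * t) (profileDeriv t) t := by
    rw [profileDeriv_of_le h]
    simpa using ((hasDerivAt_id t).const_mul (4 : ℝ)).const_sub 5
  exact h1.hasDerivWithinAt.congr (fun x hx => profile_of_le hx) (profile_of_le h)

theorem hasDerivWithinAt_profile_Ici {t : ℝ} (h : 1 ≤ t) :
    HasDerivWithinAt profile (profileDeriv t) (Ici 1) t := by
  have ht : t ≠ 0 := by positivity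
  have h1 : HasDerivAt (fun t : ℝ => (t ^ 4)⁻¹) (profileDeriv t) t := by
    rw [profileDeriv_of_ge h]
    refine ((hasDerivAt_pow 4 t).inv (by positivity)).congr_deriv ?_
    field_simp
    norm_num
    ring
  exact h1.hasDerivWithinAt.congr (fun x hx => profile_of_ge hx) (profile_of_ge h)

/-- The affine branch 5 - 4t is the tangent of t⁻⁴ at t = 1, so the one-sided derivatives agree
there. -/
theorem hasDerivAt_profile (t : ℝ) : HasDerivAt profile (profileDeriv t) t := by
  rcases lt_trichotomy t 1 with h | rfl | h
  · exact (hasDerivWithinAt_profile_Iic h.le).hasDerivAt (Iic_mem_nhds h)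
  · have := (hasDerivWithinAt_profile_Iic le_rfl).union (hasDerivWithinAt_profile_Ici le_rfl)
    rwa [Iic_union_Ici, hasDerivWithinAt_univ] at this
  · exact (hasDerivWithinAt_profile_Ici h.le).hasDerivAt (Ici_mem_nhds h)

/-- A continuously differentiable modification of the Cauchy kernel inside the unit ball. -/
def bumpKernel (u : Octonion) : Octonion := profile (‖u‖ ^ 2) • conj u

/-- The density of the modified Cauchy kernel. -/
def bumpDensity (u : Octonion) : ℝ := 40 * max (1 - ‖u‖ ^ 2) 0

theorem continuous_bumpDensity : Continuous bumpDensity := by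
  unfold bumpDensity
  fun_prop

/-- With t = |u|², the affine branch gives 8(5 - 4t) - 8t = 40(1 - t), and the branch t⁻⁴ cancels.
-/
theorem bumpDensity_eq (u : Octonion) :
    8 * profile (‖u‖ ^ 2) + 2 * ‖u‖ ^ 2 * profileDeriv (‖u‖ ^ 2) = bumpDensity u := by
  rw [bumpDensity]
  rcases le_total (‖u‖ ^ 2) 1 with h | h
  · rw [profile_of_le h, profileDeriv_of_le h, max_eq_left (by linarith)]
    ring
  · have : ‖u‖ ≠ 0 := by
      intro h0
      norm_num [h0] at h
    rw [profile_of_ge h, profileDeriv_of_ge h, max_eq_right (by linarith)]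
    field_simp
    norm_num

theorem bumpDensity_nonneg (u : Octonion) : 0 ≤ bumpDensity u := by
  unfold bumpDensity
  positivity

theorem bumpDensity_le (u : Octonion) : bumpDensity u ≤ 40 := by
  have : max (1 - ‖u‖ ^ 2) 0 ≤ 1 := max_le (by nlinarith [sq_nonneg ‖u‖]) zero_le_one
  unfold bumpDensity
  linarith

theorem bumpDensity_eq_zero {u : Octonion} (h : 1 ≤ ‖u‖) : bumpDensity u = 0 := by
  rw [bumpDensity, max_eq_right (by nlinarith), mul_zero]

theorem hasFDerivAt_bumpKernel (u : Octonion) :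
    HasFDerivAt bumpKernel (radialFDeriv (profile (‖u‖ ^ 2)) (profileDeriv (‖u‖ ^ 2)) u) u :=
  hasFDerivAt_radial (hasDerivAt_profile _)

theorem bumpKernel_eq_cauchyKernel {u : Octonion} (h : 1 ≤ ‖u‖) :
    bumpKernel u = cauchyKernel u := by
  rw [bumpKernel, profile_of_ge (by nlinarith), cauchyKernel, ← pow_mul]

theorem norm_bumpKernel_le (u : Octonion) : ‖bumpKernel u‖ ≤ 160 * ((1 + ‖u‖) ^ 5)⁻¹ := by
  have h0 := norm_nonneg u
  rw [← div_eq_mul_inv, le_div_iff₀ (by positivity)]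
  rcases le_total ‖u‖ 1 with h | h
  -- With r = ‖u‖ the norm is 5r - 4r³ ≤ 5, and 160 = 5 · 2⁵.
  · have h1 : ‖bumpKernel u‖ ≤ 5 := by
      rw [bumpKernel, profile_of_le (by nlinarith), norm_smul, norm_conj, Real.norm_eq_abs,
        abs_of_nonneg (by nlinarith)]
      nlinarith [pow_nonneg h0 3]
    calc _ ≤ 5 * (1 + 1 : ℝ) ^ 5 := by gcongr
      _ = 160 := by norm_num
  · rw [bumpKernel_eq_cauchyKernel h, norm_cauchyKernel]
    calc _ ≤ (‖u‖ ^ 5)⁻¹ * (‖u‖ + ‖u‖) ^ 5 := by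
          gcongr ?_⁻¹ * (?_ + _) ^ 5
          · exact pow_le_pow_right₀ h (by norm_num)
      _ = 32 := by
          have : ‖u‖ ≠ 0 := by positivity
          field_simp
          norm_num
      _ ≤ 160 := by norm_num

/-- In polar coordinates the integral is 8 · (π⁴/24) · ∫₀¹ (40 r⁷ - 40 r⁹) dr, and the last factor
is 5 - 4 = 1. The constant 3/π⁴ of the Hardy pairing is the inverse of this mass. -/
theorem integral_bumpDensity : ∫ u : Octonion, bumpDensity u = π ^ 4 / 3 := by
  have h := integral_fun_norm_addHaar (volume : Measure Octonion)
    (fun r => 40 * max (1 - r ^ 2) 0)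
  have hball : (volume : Measure Octonion).real (Metric.ball 0 1) = π ^ 4 / 24 := by
    rw [measureReal_def, EuclideanSpace.volume_ball]
    have hG : Gamma ((4 : ℕ) + 1 : ℝ) = 24 := by
      rw [Real.Gamma_nat_eq_factorial]
      norm_num [Nat.factorial]
    have hs : √π ^ 8 = π ^ 4 := by
      rw [show 8 = 2 * 4 from rfl, pow_mul, Real.sq_sqrt Real.pi_pos.le]
    have h4 : ((8 : ℕ) / 2 + 1 : ℝ) = (4 : ℕ) + 1 := by norm_num
    rw [Fintype.card_fin, h4, hG, hs, ENNReal.ofReal_one, one_pow, one_mul,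
      ENNReal.toReal_ofReal (by positivity)]
  have hint : ∫ y in Ioi (0 : ℝ), y ^ 7 • (40 * max (1 - y ^ 2) 0) = 1 := by
    have h1 : ∫ y in Ioi (0 : ℝ), y ^ 7 • (40 * max (1 - y ^ 2) 0) =
        ∫ y in Ioc (0 : ℝ) 1, y ^ 7 • (40 * max (1 - y ^ 2) 0) := by
      refine setIntegral_eq_of_subset_of_forall_sdiff_eq_zero measurableSet_Ioi
        (fun y hy => hy.1) fun y hy => ?_
      have hy1 : 1 < y := by
        by_contra hle
        exact hy.2 ⟨hy.1, not_lt.1 hle⟩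
      rw [max_eq_right (by nlinarith)]
      simp
    have h2 : ∫ y in Ioc (0 : ℝ) 1, y ^ 7 • (40 * max (1 - y ^ 2) 0) =
        ∫ y in Ioc (0 : ℝ) 1, (40 * y ^ 7 - 40 * y ^ 9) := by
      refine setIntegral_congr_fun measurableSet_Ioc fun y hy => ?_
      have : max (1 - y ^ 2) 0 = 1 - y ^ 2 := max_eq_left (by nlinarith [hy.1, hy.2])
      simp only [this, smul_eq_mul]
      ring
    rw [h1, h2, ← intervalIntegral.integral_of_le zero_le_one, intervalIntegral.integral_sub
      (Continuous.intervalIntegrable (by fun_prop) _ _)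
      (Continuous.intervalIntegrable (by fun_prop) _ _)]
    simp
    norm_num
  have hfr : Module.finrank ℝ Octonion = 8 := by simp
  unfold bumpDensity
  rw [h, hball, hfr, hint]
  simp
  ring

/-! ### Slices, and the divergence theorem on slabs. -/

/-- The imaginary octonions as a Euclidean space. -/
abbrev Imaginary : Type := EuclideanSpace ℝ (Fin 7)

theorem continuous_im : Continuous im :=
  (PiLp.continuous_toLp 2 _).comp (continuous_pi fun j => by unfold Fin.tail; fun_prop)

theorem continuous_point_right (t : ℝ) : Continuous (point t) :=
  continuous_point.comp (Continuous.prodMk_right t)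

/-- The splitting of an octonion into its real and imaginary parts. -/
def pointEquiv : ℝ × Imaginary ≃ᵐ Octonion where
  toFun p := point p.1 p.2
  invFun z := (z 0, im z)
  left_inv _ := rfl
  right_inv z := point_im z
  measurable_toFun := continuous_point.measurable
  measurable_invFun := (by fun_prop : Continuous fun z : Octonion => z 0).measurable.prodMk
    continuous_im.measurable

theorem measurePreserving_pointEquiv : MeasurePreserving pointEquiv := by
  have h1 : MeasurePreserving (Prod.map id (@WithLp.ofLp 2 (Fin 7 → ℝ)))
      (volume : Measure (ℝ × Imaginary)) (volume : Measure (ℝ × (Fin 7 → ℝ))) :=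
    (MeasurePreserving.id _).prod (PiLp.volume_preserving_ofLp (Fin 7))
  have h2 := (volume_preserving_piFinSuccAbove (fun _ : Fin 8 => ℝ) 0).symm
  have h := (PiLp.volume_preserving_toLp (Fin 8)).comp (h2.comp h1)
  have heq : ⇑pointEquiv = WithLp.toLp 2 ∘ (MeasurableEquiv.piFinSuccAbove (fun _ => ℝ) 0).symm ∘
      Prod.map id WithLp.ofLp := by
    funext p
    ext i
    refine Fin.cases rfl (fun j => rfl) i
  rw [heq]
  exact h

theorem measurableEmbedding_point (t : ℝ) : MeasurableEmbedding (point t) := by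
  have : MeasurableEmbedding (fun x : Imaginary => (t, x)) := measurableEmbedding_prodMk_left t
  exact pointEquiv.measurableEmbedding.comp this

/-- The divergence theorem is applied on a box; a function vanishing outside radius R has the same
integral over the box as over the slab. -/
theorem integral_slab_piece {E : Type*} [NormedAddCommGroup E] [NormedSpace ℝ E]
    (g : Octonion → E) {s₁ s₂ R : ℝ} (hg : ∀ z, R ≤ ‖z‖ → g z = 0) :
    ∫ z in slab (Icc s₁ s₂), g z =
      ∫ v in Icc (Fin.cons s₁ fun _ => -R : Fin 8 → ℝ) (Fin.cons s₂ fun _ => R),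
        g (WithLp.toLp 2 v) := by
  have hpre : ∫ z in slab (Icc s₁ s₂), g z =
      ∫ v in {v : Fin 8 → ℝ | v 0 ∈ Icc s₁ s₂}, g (WithLp.toLp 2 v) :=
    ((PiLp.volume_preserving_toLp (Fin 8)).setIntegral_preimage_emb
      (MeasurableEquiv.toLp 2 _).measurableEmbedding g (slab (Icc s₁ s₂))).symm
  rw [hpre]
  refine setIntegral_eq_of_subset_of_forall_sdiff_eq_zero
    (measurableSet_Icc.preimage (measurable_pi_apply 0)) ?_ ?_
  · intro v hv
    exact ⟨hv.1 0, hv.2 0⟩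
  · intro v hv
    refine hg _ ?_
    by_contra! hlt
    refine hv.2 ⟨fun i => ?_, fun i => ?_⟩
    · refine Fin.cases hv.1.1 (fun j => ?_) i
      exact (abs_le.1 ((PiLp.norm_apply_le (WithLp.toLp 2 v) j.succ).trans hlt.le)).1
    · refine Fin.cases hv.1.2 (fun j => ?_) i
      exact (abs_le.1 ((PiLp.norm_apply_le (WithLp.toLp 2 v) j.succ).trans hlt.le)).2

theorem toLp_insertNth_zero (s : ℝ) (v : Fin 7 → ℝ) :
    WithLp.toLp 2 ((0 : Fin 8).insertNth s v : Fin 8 → ℝ) = point s (WithLp.toLp 2 v) := by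
  ext i
  refine Fin.cases rfl (fun j => rfl) i

theorem integral_face_zero {E : Type*} [NormedAddCommGroup E] [NormedSpace ℝ E]
    (g : Octonion → E) {s R : ℝ} (hg : ∀ z, R ≤ ‖z‖ → g z = 0) :
    ∫ v in Icc (fun _ => -R : Fin 7 → ℝ) (fun _ => R),
        g (WithLp.toLp 2 ((0 : Fin 8).insertNth s v)) = ∫ x, g (point s x) := by
  simp only [toLp_insertNth_zero]
  rw [← (PiLp.volume_preserving_toLp (Fin 7)).integral_comp
    (MeasurableEquiv.toLp 2 _).measurableEmbedding]
  refine setIntegral_eq_integral_of_forall_compl_eq_zero fun v hv => hg _ ?_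
  by_contra! hlt
  have hj (j : Fin 7) : |v j| ≤ R := by
    have h1 : ‖WithLp.toLp 2 v‖ ≤ ‖point s (WithLp.toLp 2 v)‖ := norm_im_le_norm (point s _)
    exact (PiLp.norm_apply_le (WithLp.toLp 2 v) j).trans (h1.trans hlt.le)
  exact hv ⟨fun j => (abs_le.1 (hj j)).1, fun j => (abs_le.1 (hj j)).2⟩

set_option maxHeartbeats 1000000 in
/-- The divergence theorem for `χ G (e_i f)` on a slab, with a cutoff function `χ`. -/
theorem cauchy_slab_cutoff {s₁ s₂ R : ℝ} (hs : s₁ ≤ s₂) (hR : 0 < R)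
    {χ : Octonion → ℝ} (hχ : ContDiff ℝ 1 χ) (hχR : ∀ z, R ≤ ‖z‖ → χ z = 0)
    (hχR' : ∀ z, R ≤ ‖z‖ → fderiv ℝ χ z = 0)
    {G : Octonion → Octonion} {G' : Octonion → Octonion →L[ℝ] Octonion} {k : Octonion → ℝ}
    (hG : ∀ z, HasFDerivAt G (G' z) z) (hk : ∀ z a, ∑ i, G' z (e i) * (e i * a) = k z • a)
    (hkc : Continuous k) {f : Octonion → Octonion}
    (hf : ∀ z ∈ slab (Icc s₁ s₂), DifferentiableAt ℝ f z)
    (hD : ∀ z ∈ slab (Icc s₁ s₂), cauchyRiemann f z = 0) :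
    (∫ x, χ (point s₂ x) • (G (point s₂ x) * f (point s₂ x))) -
        ∫ x, χ (point s₁ x) • (G (point s₁ x) * f (point s₁ x)) =
      ∫ z in slab (Icc s₁ s₂),
        (χ z • (k z • f z) + ∑ i, fderiv ℝ χ z (e i) • (G z * (e i * f z))) := by
  set a : Fin 8 → ℝ := Fin.cons s₁ fun _ => -R with ha
  set b : Fin 8 → ℝ := Fin.cons s₂ fun _ => R with hb
  have hab : a ≤ b := by
    intro i
    refine Fin.cases hs (fun j => ?_) i
    simp only [ha, hb, Fin.cons_succ]
    linarith
  have hmem : ∀ v ∈ Icc a b, WithLp.toLp 2 v ∈ slab (Icc s₁ s₂) := fun v hv => ⟨hv.1 0, hv.2 0⟩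
  set T : (Fin 8 → ℝ) →L[ℝ] Octonion :=
    ((EuclideanSpace.equiv (Fin 8) ℝ).symm : (Fin 8 → ℝ) →L[ℝ] Octonion) with hT
  have hTe (i : Fin 8) : T (Pi.single i 1) = e i := rfl
  have hχd : ∀ z, HasFDerivAt χ (fderiv ℝ χ z) z := fun z =>
    (hχ.differentiable one_ne_zero z).hasFDerivAt
  have hχc : Continuous (fderiv ℝ χ) := hχ.continuous_fderiv one_ne_zero
  have hGc : Continuous G := continuous_iff_continuousAt.2 fun z => (hG z).continuousAt
  have hfc : ContinuousOn f (slab (Icc s₁ s₂)) := fun z hz =>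
    (hf z hz).continuousAt.continuousWithinAt
  set F : Fin 8 → Octonion → Octonion := fun i z => χ z • (G z * (e i * f z)) with hF
  have hmul {s : Set Octonion} {g₁ g₂ : Octonion → Octonion} (h₁ : ContinuousOn g₁ s)
      (h₂ : ContinuousOn g₂ s) : ContinuousOn (fun z => g₁ z * g₂ z) s :=
    (mulL.continuous.comp_continuousOn h₁).clm_apply h₂
  have hFc (i : Fin 8) : ContinuousOn (F i) (slab (Icc s₁ s₂)) :=
    hχ.continuous.continuousOn.smul (hmul hGc.continuousOn (hmul continuousOn_const hfc))
  have hFd (i : Fin 8) {z : Octonion} (hz : z ∈ slab (Icc s₁ s₂)) :=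
    (hχd z).smul (mulL.hasFDerivAt_of_bilinear (hG z)
      (mulL.hasFDerivAt_of_bilinear (hasFDerivAt_const (e i) z) (hf z hz).hasFDerivAt))
  have hFdiff (i : Fin 8) {z : Octonion} (hz : z ∈ slab (Icc s₁ s₂)) : DifferentiableAt ℝ (F i) z :=
    (hFd i hz).differentiableAt
  have hdiv {z : Octonion} (hz : z ∈ slab (Icc s₁ s₂)) :
      ∑ i, fderiv ℝ (F i) z (e i) =
        χ z • (k z • f z) + ∑ i, fderiv ℝ χ z (e i) • (G z * (e i * f z)) := by
    have hi (i : Fin 8) : fderiv ℝ (F i) z (e i) = χ z • (G z * (e i * fderiv ℝ f z (e i))) +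
        χ z • (G' z (e i) * (e i * f z)) + fderiv ℝ χ z (e i) • (G z * (e i * f z)) := by
      have h1 : fderiv ℝ (F i) z = _ := (hFd i hz).fderiv
      rw [h1]
      simp [mulL_apply, smul_add]
    -- Additivity in the second factor collects this sum into χ G (Df).
    have hz0 : ∑ i, χ z • (G z * (e i * fderiv ℝ f z (e i))) = 0 := by
      rw [← Finset.smul_sum]
      have := congrArg (fun x => mulL (G z) x) (hD z hz)
      simp only [cauchyRiemann, map_sum, map_zero] at this
      simp only [mulL_apply] at this
      rw [this, smul_zero]
    simp only [hi, Finset.sum_add_distrib]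
    rw [hz0, zero_add, ← Finset.smul_sum, hk]
  have hcontdiv : ContinuousOn (fun z => χ z • (k z • f z) +
      ∑ i, fderiv ℝ χ z (e i) • (G z * (e i * f z))) (slab (Icc s₁ s₂)) := by
    refine (hχ.continuous.continuousOn.smul (hkc.continuousOn.smul hfc)).add
      (continuousOn_finsetSum _ fun i _ => ?_)
    exact (hχc.clm_apply continuous_const).continuousOn.smul
      (hmul hGc.continuousOn (hmul continuousOn_const hfc))
  have key := integral_divergence_of_hasFDerivAt_off_countable' a b hab
    (fun i v => F i (T v)) (fun i v => (fderiv ℝ (F i) (T v)).comp T) ∅ countable_empty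
    (fun i => (hFc i).comp T.continuous.continuousOn hmem)
    (fun v hv i => ((hFdiff i (hmem v ⟨fun j => (hv.1 j trivial).1.le,
      fun j => (hv.1 j trivial).2.le⟩)).hasFDerivAt).comp v T.hasFDerivAt)
    (by
      refine (ContinuousOn.integrableOn_compact isCompact_Icc
        (hcontdiv.comp T.continuous.continuousOn hmem)).congr_fun (fun v hv => ?_) measurableSet_Icc
      simp only [ContinuousLinearMap.comp_apply, hTe]
      exact (hdiv (hmem v hv)).symm)
  have hlhs : ∫ v in Icc a b, ∑ i, ((fderiv ℝ (F i) (T v)).comp T) (Pi.single i 1) =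
      ∫ z in slab (Icc s₁ s₂),
        (χ z • (k z • f z) + ∑ i, fderiv ℝ χ z (e i) • (G z * (e i * f z))) := by
    rw [integral_slab_piece _ (R := R) (fun z hz => by simp [hχR z hz, hχR' z hz])]
    refine setIntegral_congr_fun measurableSet_Icc fun v hv => ?_
    simp only [ContinuousLinearMap.comp_apply, hTe]
    exact hdiv (hmem v hv)
  rw [← hlhs, key, Fin.sum_univ_succ, Finset.sum_eq_zero, add_zero]
  · have h0 (s : ℝ) := integral_face_zero (fun z => χ z • (G z * f z)) (s := s) (R := R)
      (fun z hz => by simp [hχR z hz])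
    rw [← h0, ← h0]
    simp only [hF, e_zero_mul]
    rfl
  -- The side faces have a coordinate of absolute value R, where the cutoff vanishes.
  · intro i _
    have hFz (c : ℝ) (hc : |c| = R) (x : Fin 7 → ℝ) :
        F i.succ (T (i.succ.insertNth c x)) = 0 := by
      have : R ≤ ‖T (i.succ.insertNth c x)‖ := by
        refine le_trans ?_ (PiLp.norm_apply_le _ i.succ)
        simp [hT, ← hc]
      simp only [hF, hχR _ this, zero_smul]
    have h1 : |b i.succ| = R := by simp [hb, abs_of_pos hR]
    have h2 : |a i.succ| = R := by simp [ha, abs_of_pos hR]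
    simp only [hFz _ h1, hFz _ h2, integral_zero, sub_zero]

/-! ### The decay weight and removal of the cutoff. -/

/-- A square-integrable weight on the imaginary octonions. -/
def decay (x : Imaginary) : ℝ := ((1 + ‖x‖) ^ 5)⁻¹

theorem decay_nonneg (x : Imaginary) : 0 ≤ decay x := by
  unfold decay
  positivity

theorem continuous_decay : Continuous decay :=
  (by fun_prop : Continuous fun x : Imaginary => (1 + ‖x‖) ^ 5).inv₀ fun x => by positivity

/-- The squared weight has exponent 10, which exceeds the dimension 7. Using 5 of the 7 powers of
the Cauchy kernel here leaves two for the real direction, needed both for decay as Re z → ∞ and for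
summability over n. -/
theorem memLp_decay : MemLp decay 2 volume := by
  rw [memLp_two_iff_integrable_sq continuous_decay.aestronglyMeasurable]
  refine (integrable_one_add_norm (E := Imaginary) (μ := volume) (r := 10)
    (by norm_num)).congr (Eventually.of_forall fun x => ?_)
  have : (0 : ℝ) < 1 + ‖x‖ := by positivity
  simp only [decay]
  rw [Real.rpow_neg this.le, inv_pow, ← pow_mul, show (10 : ℝ) = ((10 : ℕ) : ℝ) by norm_num,
    Real.rpow_natCast]

theorem memLp_decay_sub (y : Imaginary) : MemLp (fun x => decay (x - y)) 2 volume :=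
  memLp_decay.comp_measurePreserving (measurePreserving_sub_right volume y)

theorem eLpNorm_decay_sub (y : Imaginary) :
    eLpNorm (fun x => decay (x - y)) 2 volume = eLpNorm decay 2 volume :=
  eLpNorm_comp_measurePreserving memLp_decay.1 (measurePreserving_sub_right volume y)

/-- The `L²` norm of the weight `decay`. -/
def decayNorm : ℝ := (eLpNorm decay 2 volume).toReal

theorem decayNorm_nonneg : 0 ≤ decayNorm := ENNReal.toReal_nonneg

theorem integrable_decay_mul {g : Imaginary → Octonion} (hg : MemLp g 2 volume) (y : Imaginary) :
    Integrable (fun x => decay (x - y) * ‖g x‖) volume :=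
  (memLp_decay_sub y).integrable_mul hg.norm

/-- Cauchy–Schwarz; translation invariance makes the constant independent of y. -/
theorem integral_decay_mul_le {g : Imaginary → Octonion} (hg : MemLp g 2 volume) (y : Imaginary) :
    ∫ x, decay (x - y) * ‖g x‖ ≤ decayNorm * (eLpNorm g 2 volume).toReal := by
  have h1 : ∫ x, decay (x - y) * ‖g x‖ =
      (eLpNorm ((fun x => decay (x - y)) • g) 1 volume).toReal := by
    rw [eLpNorm_one_eq_lintegral_enorm, ← integral_norm_eq_lintegral_enorm]
    · refine integral_congr_ae (Eventually.of_forall fun x => ?_)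
      simp [norm_smul, abs_of_nonneg (decay_nonneg _)]
    · exact (memLp_decay_sub y).1.smul hg.1
  rw [h1, decayNorm, ← ENNReal.toReal_mul, ← eLpNorm_decay_sub y]
  refine ENNReal.toReal_mono (ENNReal.mul_ne_top (memLp_decay_sub y).2.ne hg.2.ne) ?_
  exact eLpNorm_smul_le_mul_eLpNorm hg.1 (memLp_decay_sub y).1

theorem aestronglyMeasurable_mul {α : Type*} [MeasurableSpace α] {μ : Measure α}
    {A g : α → Octonion} (hA : AEStronglyMeasurable A μ) (hg : AEStronglyMeasurable g μ) :
    AEStronglyMeasurable (fun x => A x * g x) μ :=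
  mulL.aestronglyMeasurable_comp₂ hA hg

theorem integrable_mul_of_decay {A g : Imaginary → Octonion} {C : ℝ} {y : Imaginary}
    (hA : AEStronglyMeasurable A volume) (hAC : ∀ x, ‖A x‖ ≤ C * decay (x - y))
    (hg : MemLp g 2 volume) : Integrable (fun x => A x * g x) volume := by
  refine ((integrable_decay_mul hg y).const_mul C).mono' (aestronglyMeasurable_mul hA hg.1)
    (Eventually.of_forall fun x => ?_)
  rw [Octonion.norm_mul, ← mul_assoc]
  gcongr
  exact hAC x

theorem norm_integral_mul_le_of_decay {A g : Imaginary → Octonion} {C : ℝ} {y : Imaginary}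
    (hAC : ∀ x, ‖A x‖ ≤ C * decay (x - y)) (hC : 0 ≤ C)
    (hg : MemLp g 2 volume) :
    ‖∫ x, A x * g x‖ ≤ C * (decayNorm * (eLpNorm g 2 volume).toReal) := by
  calc _ ≤ ∫ x, C * (decay (x - y) * ‖g x‖) := by
        refine norm_integral_le_of_norm_le ((integrable_decay_mul hg y).const_mul C)
          (Eventually.of_forall fun x => ?_)
        rw [Octonion.norm_mul, ← mul_assoc]
        gcongr
        exact hAC x
    _ = C * ∫ x, decay (x - y) * ‖g x‖ := integral_const_mul _ _
    _ ≤ _ := by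
        gcongr
        exact integral_decay_mul_le hg y

theorem measurableSet_slab {I : Set ℝ} (hI : MeasurableSet I) : MeasurableSet (slab I) :=
  hI.preimage (by fun_prop : Continuous fun z : Octonion => z 0).measurable

/-- Fubini: the slice integrals are uniformly bounded and the interval of slices has finite length.
-/
theorem integrableOn_slab_decay_mul {s₁ s₂ C : ℝ} {f : Octonion → Octonion} (y : Imaginary)
    (hf : ContinuousOn f (slab (Icc s₁ s₂)))
    (hL : ∀ s ∈ Icc s₁ s₂, MemLp (fun x => f (point s x)) 2 volume ∧
      (eLpNorm (fun x => f (point s x)) 2 volume).toReal ≤ C) :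
    IntegrableOn (fun z => decay (im z - y) * ‖f z‖) (slab (Icc s₁ s₂)) := by
  have hms : MeasurableSet (slab (Icc s₁ s₂)) := measurableSet_slab measurableSet_Icc
  rw [← measurePreserving_pointEquiv.integrableOn_comp_preimage pointEquiv.measurableEmbedding]
  have hmeas : AEStronglyMeasurable (fun z => decay (im z - y) * ‖f z‖)
      (volume.restrict (slab (Icc s₁ s₂))) :=
    (continuous_decay.comp (continuous_im.sub continuous_const)).aestronglyMeasurable.mul
      (hf.aestronglyMeasurable hms).norm
  have hmeas2 := hmeas.comp_measurePreserving
    (measurePreserving_pointEquiv.restrict_preimage hms)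
  have hpre : pointEquiv ⁻¹' slab (Icc s₁ s₂) = Icc s₁ s₂ ×ˢ univ := by
    ext p
    exact ⟨fun h => ⟨h, trivial⟩, fun h => h.1⟩
  rw [hpre] at hmeas2 ⊢
  rw [IntegrableOn]
  rw [Measure.volume_eq_prod, ← Measure.prod_restrict, Measure.restrict_univ] at hmeas2 ⊢
  rw [integrable_prod_iff hmeas2]
  constructor
  · filter_upwards [ae_restrict_mem measurableSet_Icc] with s hs
    exact integrable_decay_mul (hL s hs).1 y
  · refine Integrable.mono' (g := fun _ => decayNorm * C) (integrable_const _)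
      hmeas2.norm.integral_prod_right' ?_
    filter_upwards [ae_restrict_mem measurableSet_Icc] with s hs
    rw [Real.norm_of_nonneg (integral_nonneg fun _ => norm_nonneg _)]
    calc _ = ∫ x, decay (x - y) * ‖f (point s x)‖ := by
          refine integral_congr_ae (Eventually.of_forall fun x => ?_)
          exact Real.norm_of_nonneg (mul_nonneg (decay_nonneg _) (norm_nonneg _))
      _ ≤ _ := (integral_decay_mul_le (hL s hs).1 y).trans
          (mul_le_mul_of_nonneg_left (hL s hs).2 decayNorm_nonneg)

/-- Dilates of one bump. A uniform gradient bound suffices for dominated convergence, because at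
each point the gradient is eventually zero. -/
theorem exists_cutoff : ∃ (M : ℝ) (χ : ℕ → Octonion → ℝ), 0 ≤ M ∧ ∀ n : ℕ,
    ContDiff ℝ 1 (χ n) ∧ (∀ z, |χ n z| ≤ 1) ∧ (∀ z, ‖fderiv ℝ (χ n) z‖ ≤ M) ∧
    (∀ z, 3 * ((n : ℝ) + 1) ≤ ‖z‖ → χ n z = 0 ∧ fderiv ℝ (χ n) z = 0) ∧
    (∀ z, ‖z‖ < (n : ℝ) + 1 → χ n z = 1 ∧ fderiv ℝ (χ n) z = 0) := by
  let b : ContDiffBump (0 : Octonion) := ⟨1, 2, one_pos, one_lt_two⟩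
  have hb : ContDiff ℝ 1 b := b.contDiff
  obtain ⟨M, hM⟩ := (b.hasCompactSupport.fderiv (𝕜 := ℝ)).exists_bound_of_continuous
    (hb.continuous_fderiv one_ne_zero)
  have hM0 : 0 ≤ M := (norm_nonneg _).trans (hM 0)
  refine ⟨M, fun n z => b (((n : ℝ) + 1)⁻¹ • z), hM0, fun n => ?_⟩
  have hn : (0 : ℝ) < (n : ℝ) + 1 := by positivity
  have hnorm (z : Octonion) : ‖((n : ℝ) + 1)⁻¹ • z‖ = ‖z‖ / ((n : ℝ) + 1) := by
    rw [norm_smul, norm_inv, Real.norm_of_nonneg hn.le]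
    ring
  have hc (z : Octonion) : ContinuousAt (fun z : Octonion => ‖z‖) z := continuous_norm.continuousAt
  have hone {z : Octonion} (hz : ‖z‖ < (n : ℝ) + 1) : b (((n : ℝ) + 1)⁻¹ • z) = 1 := by
    refine b.one_of_mem_closedBall ?_
    rw [mem_closedBall_zero_iff, hnorm, div_le_one hn]
    exact hz.le
  have hzero {z : Octonion} (hz : 2 * ((n : ℝ) + 1) < ‖z‖) : b (((n : ℝ) + 1)⁻¹ • z) = 0 := by
    refine b.zero_of_le_dist ?_
    rw [dist_zero_right, hnorm, le_div_iff₀ hn]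
    exact hz.le
  refine ⟨hb.comp (contDiff_const_smul _), fun z => ?_, fun z => ?_, fun z hz => ?_,
    fun z hz => ?_⟩
  · rw [abs_of_nonneg b.nonneg]
    exact b.le_one
  · have h1 : HasFDerivAt (fun z => b (((n : ℝ) + 1)⁻¹ • z)) ((fderiv ℝ b (((n : ℝ) + 1)⁻¹ • z)).comp
        (((n : ℝ) + 1)⁻¹ • ContinuousLinearMap.id ℝ Octonion)) z :=
      ((hb.differentiable one_ne_zero _).hasFDerivAt).comp z
        ((hasFDerivAt_id z).const_smul ((n : ℝ) + 1)⁻¹)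
    rw [h1.fderiv, ContinuousLinearMap.comp_smul, ContinuousLinearMap.comp_id, norm_smul, norm_inv,
      Real.norm_of_nonneg hn.le]
    calc _ ≤ 1 * M := by
          gcongr
          · exact inv_le_one_of_one_le₀ (by linarith [(Nat.cast_nonneg n : (0 : ℝ) ≤ n)])
          · exact hM _
      _ = M := one_mul M
  -- The bump already vanishes beyond 2(n+1); the radius 3(n+1) puts z inside an open set of zeros,
  -- so the derivative vanishes too.
  · have hz' : 2 * ((n : ℝ) + 1) < ‖z‖ := by linarith
    refine ⟨hzero hz', ?_⟩
    have : (fun z => b (((n : ℝ) + 1)⁻¹ • z)) =ᶠ[𝓝 z] fun _ => 0 := by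
      filter_upwards [(hc z).eventually (lt_mem_nhds hz')] with x hx using hzero hx
    rw [this.fderiv_eq, fderiv_const_apply]
  · refine ⟨hone hz, ?_⟩
    have : (fun z => b (((n : ℝ) + 1)⁻¹ • z)) =ᶠ[𝓝 z] fun _ => 1 := by
      filter_upwards [(hc z).eventually (gt_mem_nhds hz)] with x hx using hone hx
    rw [this.fderiv_eq, fderiv_const_apply]

/-- The divergence theorem for `G (e_i f)` on a slab, for `f` bounded in `L²` on the slices and
a kernel `G` with sufficient decay. -/
theorem cauchy_slab {s₁ s₂ : ℝ} (hs : s₁ ≤ s₂)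
    {G : Octonion → Octonion} {G' : Octonion → Octonion →L[ℝ] Octonion} {k : Octonion → ℝ}
    {C : ℝ} {y : Imaginary}
    (hG : ∀ z, HasFDerivAt G (G' z) z) (hk : ∀ z a, ∑ i, G' z (e i) * (e i * a) = k z • a)
    (hkc : Continuous k) (hGC : ∀ z, ‖G z‖ ≤ C * decay (im z - y))
    (hkC : ∀ z, |k z| ≤ C * decay (im z - y)) {f : Octonion → Octonion}
    (hf : ∀ z ∈ slab (Icc s₁ s₂), DifferentiableAt ℝ f z)
    (hD : ∀ z ∈ slab (Icc s₁ s₂), cauchyRiemann f z = 0) {B : ℝ}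
    (hL : ∀ s ∈ Icc s₁ s₂, MemLp (fun x => f (point s x)) 2 volume ∧
      (eLpNorm (fun x => f (point s x)) 2 volume).toReal ≤ B) :
    (∫ x, G (point s₂ x) * f (point s₂ x)) - ∫ x, G (point s₁ x) * f (point s₁ x) =
      ∫ z in slab (Icc s₁ s₂), k z • f z := by
  obtain ⟨M, χ, hM0, hχ⟩ := exists_cutoff
  have hms : MeasurableSet (slab (Icc s₁ s₂)) := measurableSet_slab measurableSet_Icc
  have hGc : Continuous G := continuous_iff_continuousAt.2 fun z => (hG z).continuousAt
  have hfc : ContinuousOn f (slab (Icc s₁ s₂)) := fun z hz =>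
    (hf z hz).continuousAt.continuousWithinAt
  have hlarge (z : Octonion) : ∀ᶠ n : ℕ in atTop, ‖z‖ < (n : ℝ) + 1 := by
    obtain ⟨N, hN⟩ := exists_nat_gt ‖z‖
    filter_upwards [eventually_ge_atTop N] with n hn
    have : (N : ℝ) ≤ n := by exact_mod_cast hn
    linarith
  have hface (s : ℝ) (hsI : s ∈ Icc s₁ s₂) :
      Tendsto (fun n => ∫ x, χ n (point s x) • (G (point s x) * f (point s x))) atTop
        (𝓝 (∫ x, G (point s x) * f (point s x))) := by
    refine tendsto_integral_of_dominated_convergence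
      (fun x => C * (decay (x - y) * ‖f (point s x)‖)) (fun n => ?_)
      ((integrable_decay_mul (hL s hsI).1 y).const_mul C) (fun n => ?_) ?_
    · exact ((hχ n).1.continuous.comp (continuous_point_right s)).aestronglyMeasurable.smul
        (aestronglyMeasurable_mul (hGc.comp (continuous_point_right s)).aestronglyMeasurable
          (hL s hsI).1.1)
    · refine Eventually.of_forall fun x => ?_
      rw [norm_smul, Octonion.norm_mul, ← mul_assoc C]
      calc _ ≤ 1 * (C * decay (x - y) * ‖f (point s x)‖) := by
            gcongr
            · exact (hχ n).2.1 _
            · exact hGC (point s x)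
        _ = _ := one_mul _
    · refine Eventually.of_forall fun x => ?_
      refine tendsto_const_nhds.congr' ?_
      filter_upwards [hlarge (point s x)] with n hn
      rw [((hχ n).2.2.2.2 _ hn).1, one_smul]
  have hbulk : Tendsto (fun n => ∫ z in slab (Icc s₁ s₂),
      (χ n z • (k z • f z) + ∑ i, fderiv ℝ (χ n) z (e i) • (G z * (e i * f z)))) atTop
        (𝓝 (∫ z in slab (Icc s₁ s₂), k z • f z)) := by
    refine tendsto_integral_of_dominated_convergence
      -- The 1 accounts for the density term, 8M for the eight gradient terms.
      (fun z => (C * (1 + 8 * M)) * (decay (im z - y) * ‖f z‖)) (fun n => ?_)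
      ((integrableOn_slab_decay_mul y hfc hL).const_mul _) (fun n => ?_) ?_
    · have hmul {g₁ g₂ : Octonion → Octonion} (h₁ : ContinuousOn g₁ (slab (Icc s₁ s₂)))
          (h₂ : ContinuousOn g₂ (slab (Icc s₁ s₂))) :
          ContinuousOn (fun z => g₁ z * g₂ z) (slab (Icc s₁ s₂)) :=
        (mulL.continuous.comp_continuousOn h₁).clm_apply h₂
      refine ContinuousOn.aestronglyMeasurable ?_ hms
      refine ((hχ n).1.continuous.continuousOn.smul (hkc.continuousOn.smul hfc)).add
        (continuousOn_finsetSum _ fun i _ => ?_)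
      exact (((hχ n).1.continuous_fderiv one_ne_zero).clm_apply
        continuous_const).continuousOn.smul
          (hmul hGc.continuousOn (hmul continuousOn_const hfc))
    · refine Eventually.of_forall fun z => ?_
      have he (i : Fin 8) : ‖e i‖ = 1 := by simp [e]
      have h1 : ‖χ n z • (k z • f z)‖ ≤ 1 * (C * decay (im z - y) * ‖f z‖) := by
        rw [norm_smul, norm_smul]
        gcongr
        · exact (hχ n).2.1 z
        · exact hkC z
      have h2 (i : Fin 8) : ‖fderiv ℝ (χ n) z (e i) • (G z * (e i * f z))‖ ≤
          M * (C * decay (im z - y) * ‖f z‖) := by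
        rw [norm_smul, Octonion.norm_mul, Octonion.norm_mul, he, one_mul]
        gcongr
        · refine ((fderiv ℝ (χ n) z).le_opNorm _).trans ?_
          rw [he, mul_one]
          exact (hχ n).2.2.1 z
        · exact hGC z
      refine (norm_add_le _ _).trans ((add_le_add h1 (norm_sum_le_of_le _ fun i _ => h2 i)).trans ?_)
      simp only [Finset.sum_const, Finset.card_univ, Fintype.card_fin, nsmul_eq_mul]
      apply le_of_eq
      push_cast
      ring
    · refine Eventually.of_forall fun z => ?_
      refine tendsto_const_nhds.congr' ?_
      filter_upwards [hlarge z] with n hn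
      rw [((hχ n).2.2.2.2 _ hn).1, ((hχ n).2.2.2.2 _ hn).2]
      simp
  have hR (n : ℕ) : 0 < 3 * ((n : ℝ) + 1) := by positivity
  refine tendsto_nhds_unique
    ((hface s₂ (right_mem_Icc.2 hs)).sub (hface s₁ (left_mem_Icc.2 hs))) (hbulk.congr fun n => ?_)
  exact (cauchy_slab_cutoff hs (hR n) (hχ n).1 (fun z hz => ((hχ n).2.2.2.1 z hz).1)
    (fun z hz => ((hχ n).2.2.2.1 z hz).2) hG hk hkc hf hD).symm

/-! ### The Cauchy formula on closed slabs. -/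

theorem bumpDensity_le_decay (u : Octonion) : bumpDensity u ≤ 1280 * ((1 + ‖u‖) ^ 5)⁻¹ := by
  have h0 := norm_nonneg u
  rcases le_total 1 ‖u‖ with h | h
  · rw [bumpDensity_eq_zero h]
    positivity
  · rw [← div_eq_mul_inv, le_div_iff₀ (by positivity)]
    calc _ ≤ 40 * (1 + 1 : ℝ) ^ 5 := by
          gcongr
          exact bumpDensity_le u
      _ = 1280 := by norm_num

theorem scaled_decay_le {c : ℝ} (hc : 1 ≤ c) (z w : Octonion) :
    ((1 + ‖c • (z - w)‖) ^ 5)⁻¹ ≤ decay (im z - im w) := by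
  unfold decay
  have h1 : ‖im z - im w‖ ≤ ‖z - w‖ := norm_im_le_norm (z - w)
  have h2 : ‖z - w‖ ≤ ‖c • (z - w)‖ := by
    rw [norm_smul, Real.norm_of_nonneg (by linarith)]
    nlinarith [norm_nonneg (z - w)]
  gcongr
  exact h1.trans h2

/-- The Cauchy kernel is homogeneous of degree -7. -/
theorem scaled_bumpKernel_eq {c : ℝ} (hc : 0 < c) {u : Octonion} (h : 1 ≤ c * ‖u‖) :
    c ^ 7 • bumpKernel (c • u) = cauchyKernel u := by
  have hn : ‖c • u‖ = c * ‖u‖ := by rw [norm_smul, Real.norm_of_nonneg hc.le]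
  have hu : ‖u‖ ≠ 0 := by
    intro h0
    norm_num [h0] at h
  rw [bumpKernel_eq_cauchyKernel (hn ▸ h), cauchyKernel, cauchyKernel, hn, conj_smul, smul_smul,
    smul_smul]
  congr 1
  field_simp

/-- The kernel is modified only within distance 1/c of w, so both bounding hyperplanes see the true
Cauchy kernel and the left side does not depend on c. -/
theorem cauchy_slab_scaled {s₁ s₂ : ℝ} (hs : s₁ ≤ s₂) {f : Octonion → Octonion}
    (hf : ∀ z ∈ slab (Icc s₁ s₂), DifferentiableAt ℝ f z)
    (hD : ∀ z ∈ slab (Icc s₁ s₂), cauchyRiemann f z = 0) {B : ℝ}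
    (hL : ∀ s ∈ Icc s₁ s₂, MemLp (fun x => f (point s x)) 2 volume ∧
      (eLpNorm (fun x => f (point s x)) 2 volume).toReal ≤ B) {c : ℝ} (hc : 1 ≤ c) (w : Octonion)
    (h₁ : 1 ≤ c * |s₁ - w 0|) (h₂ : 1 ≤ c * |s₂ - w 0|) :
    (∫ x, cauchyKernel (point s₂ x - w) * f (point s₂ x)) -
        ∫ x, cauchyKernel (point s₁ x - w) * f (point s₁ x) =
      ∫ z in slab (Icc s₁ s₂), (c ^ 8 * bumpDensity (c • (z - w))) • f z := by
  have hc0 : 0 < c := by linarith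
  have hface {s : ℝ} (h : 1 ≤ c * |s - w 0|) (x : Imaginary) :
      c ^ 7 • bumpKernel (c • (point s x - w)) = cauchyKernel (point s x - w) := by
    refine scaled_bumpKernel_eq hc0 (h.trans ?_)
    gcongr
    exact abs_re_le_norm (point s x - w)
  have key := cauchy_slab hs (G := fun z => c ^ 7 • bumpKernel (c • (z - w)))
    (G' := fun z => c ^ 8 • radialFDeriv (profile (‖c • (z - w)‖ ^ 2))
      (profileDeriv (‖c • (z - w)‖ ^ 2)) (c • (z - w)))
    -- Differentiating the dilate adds a factor c to c⁷. The constant C is a crude common bound for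
    -- the kernel and the density.
    (k := fun z => c ^ 8 * bumpDensity (c • (z - w))) (C := 1280 * c ^ 8) (y := im w)
    (fun z => by
      refine (((hasFDerivAt_bumpKernel (c • (z - w))).comp z
        (((hasFDerivAt_id z).sub_const w).const_smul c)).const_smul (c ^ 7)).congr_fderiv ?_
      ext1 v
      simp only [ContinuousLinearMap.comp_apply, smul_apply, ContinuousLinearMap.id_apply,
        map_smul, smul_smul]
      ring_nf)
    (fun z a => by
      simp only [smul_apply, Octonion.smul_mul, ← Finset.smul_sum]
      rw [sum_radialFDeriv_mul, bumpDensity_eq, smul_smul])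
    (continuous_const.mul (continuous_bumpDensity.comp (by fun_prop)))
    (fun z => by
      rw [norm_smul, Real.norm_of_nonneg (by positivity)]
      calc _ ≤ c ^ 7 * (160 * decay (im z - im w)) := by
            gcongr
            exact (norm_bumpKernel_le _).trans (by gcongr; exact scaled_decay_le hc z w)
        _ ≤ c ^ 8 * (1280 * decay (im z - im w)) := by
            have := decay_nonneg (im z - im w)
            gcongr
            · norm_num
            · norm_num
        _ = _ := by ring)
    (fun z => by
      rw [abs_of_nonneg (mul_nonneg (by positivity) (bumpDensity_nonneg _))]
      calc _ ≤ c ^ 8 * (1280 * decay (im z - im w)) := by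
            gcongr
            exact (bumpDensity_le_decay _).trans (by gcongr; exact scaled_decay_le hc z w)
        _ = _ := by ring) hf hD hL
  simpa only [hface h₁, hface h₂] using key

/-- For large c the density lives in a ball about w that does not meet the slab in its interior. -/
theorem cauchy_formula_of_notMem {s₁ s₂ : ℝ} (hs : s₁ ≤ s₂) {f : Octonion → Octonion}
    (hf : ∀ z ∈ slab (Icc s₁ s₂), DifferentiableAt ℝ f z)
    (hD : ∀ z ∈ slab (Icc s₁ s₂), cauchyRiemann f z = 0) {B : ℝ}
    (hL : ∀ s ∈ Icc s₁ s₂, MemLp (fun x => f (point s x)) 2 volume ∧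
      (eLpNorm (fun x => f (point s x)) 2 volume).toReal ≤ B) {w : Octonion}
    (hw : w 0 ∉ Icc s₁ s₂) :
    (∫ x, cauchyKernel (point s₂ x - w) * f (point s₂ x)) -
        ∫ x, cauchyKernel (point s₁ x - w) * f (point s₁ x) = 0 := by
  obtain ⟨δ, hδ, hball⟩ : ∃ δ > 0, ∀ s ∈ Icc s₁ s₂, δ ≤ |s - w 0| := by
    obtain ⟨δ, hδ, h⟩ := Metric.isOpen_iff.1 isClosed_Icc.isOpen_compl (w 0) hw
    exact ⟨δ, hδ, fun s hsI => not_lt.1 fun hlt => h (Metric.mem_ball.2 hlt) hsI⟩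
  obtain ⟨c, hc1, hcδ⟩ : ∃ c : ℝ, 1 ≤ c ∧ 1 ≤ c * δ :=
    ⟨max 1 δ⁻¹, le_max_left _ _, by
      rw [← inv_mul_cancel₀ hδ.ne']
      gcongr
      exact le_max_right _ _⟩
  have hcs : ∀ s ∈ Icc s₁ s₂, 1 ≤ c * |s - w 0| := fun s hsI =>
    hcδ.trans (by gcongr; exact hball s hsI)
  rw [cauchy_slab_scaled hs hf hD hL hc1 w (hcs _ (left_mem_Icc.2 hs)) (hcs _ (right_mem_Icc.2 hs))]
  refine setIntegral_eq_zero_of_forall_eq_zero fun z hz => ?_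
  rw [bumpDensity_eq_zero, mul_zero, zero_smul]
  rw [norm_smul, Real.norm_of_nonneg (by linarith)]
  exact (hcs _ hz).trans (by gcongr; exact abs_re_le_norm (z - w))

theorem cauchy_formula_of_mem {s₁ s₂ : ℝ} {f : Octonion → Octonion}
    (hf : ∀ z ∈ slab (Icc s₁ s₂), DifferentiableAt ℝ f z)
    (hD : ∀ z ∈ slab (Icc s₁ s₂), cauchyRiemann f z = 0) {B : ℝ}
    (hL : ∀ s ∈ Icc s₁ s₂, MemLp (fun x => f (point s x)) 2 volume ∧
      (eLpNorm (fun x => f (point s x)) 2 volume).toReal ≤ B) {w : Octonion}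
    (hw : w 0 ∈ Ioo s₁ s₂) :
    (∫ x, cauchyKernel (point s₂ x - w) * f (point s₂ x)) -
        ∫ x, cauchyKernel (point s₁ x - w) * f (point s₁ x) = (π ^ 4 / 3) • f w := by
  have hs : s₁ ≤ s₂ := hw.1.le.trans hw.2.le
  have hms : MeasurableSet (slab (Icc s₁ s₂)) := measurableSet_slab measurableSet_Icc
  obtain ⟨δ, hδ, hδ₁, hδ₂⟩ : ∃ δ > 0, δ ≤ w 0 - s₁ ∧ δ ≤ s₂ - w 0 :=
    ⟨min (w 0 - s₁) (s₂ - w 0), lt_min (sub_pos.2 hw.1) (sub_pos.2 hw.2),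
      min_le_left _ _, min_le_right _ _⟩
  have hsub : Metric.closedBall w δ ⊆ slab (Icc s₁ s₂) := by
    intro z hz
    have h := abs_le.1 ((abs_re_le_norm (z - w)).trans (mem_closedBall_iff_norm.1 hz))
    simp only [PiLp.sub_apply] at h
    exact ⟨by linarith [h.1], by linarith [h.2]⟩
  -- The approximate-identity theorem asks for an integrable function on the whole space; truncating
  -- to a ball inside the slab supplies one without changing f near w.
  set g : Octonion → Octonion := (Metric.closedBall w δ).indicator f with hg
  have hgi : Integrable g := by
    rw [hg, integrable_indicator_iff measurableSet_closedBall]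
    exact ContinuousOn.integrableOn_compact (isCompact_closedBall w δ) fun z hz =>
      (hf z (hsub hz)).continuousAt.continuousWithinAt
  have hwI : w ∈ slab (Icc s₁ s₂) := ⟨hw.1.le, hw.2.le⟩
  have hgw : g =ᶠ[𝓝 w] f := by
    filter_upwards [Metric.closedBall_mem_nhds w hδ] with z hz using indicator_of_mem hz f
  have hgc : ContinuousAt g w := (hf w hwI).continuousAt.congr hgw.symm
  have hpeak := tendsto_integral_comp_smul_smul_of_integrable' (μ := (volume : Measure Octonion))
    (φ := fun u => 3 / π ^ 4 * bumpDensity u) (g := g) (x₀ := w)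
    (fun u => mul_nonneg (by positivity) (bumpDensity_nonneg u))
    (by
      rw [integral_const_mul, integral_bumpDensity]
      field_simp)
    (by
      refine tendsto_const_nhds.congr' ?_
      filter_upwards [(tendsto_norm_cobounded_atTop (E := Octonion)).eventually_ge_atTop 1] with u hu
      rw [bumpDensity_eq_zero hu]
      simp) hgi hgc
  -- The integrals are constant once the density fits in the ball, so their limit is the boundary
  -- expression.
  have hconst : ∀ᶠ c : ℝ in atTop,
      (∫ z, (c ^ Module.finrank ℝ Octonion * (3 / π ^ 4 * bumpDensity (c • (w - z)))) • g z) =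
      (3 / π ^ 4) • ((∫ x, cauchyKernel (point s₂ x - w) * f (point s₂ x)) -
        ∫ x, cauchyKernel (point s₁ x - w) * f (point s₁ x)) := by
    filter_upwards [eventually_ge_atTop 1, eventually_ge_atTop δ⁻¹] with c hc1 hc
    have hcδ : 1 ≤ c * δ := by
      rw [← inv_mul_cancel₀ hδ.ne']
      gcongr
    rw [cauchy_slab_scaled hs hf hD hL hc1 w
      (hcδ.trans (by gcongr; rw [abs_sub_comm]; exact hδ₁.trans (le_abs_self _)))
      (hcδ.trans (by gcongr; exact hδ₂.trans (le_abs_self _))), ← integral_smul]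
    have hfr : Module.finrank ℝ Octonion = 8 := by simp
    rw [← integral_indicator hms, hfr]
    refine integral_congr_ae (Eventually.of_forall fun z => ?_)
    have hsymm : bumpDensity (c • (w - z)) = bumpDensity (c • (z - w)) := by
      simp only [bumpDensity, norm_smul, norm_sub_rev]
    by_cases hz : z ∈ Metric.closedBall w δ
    · simp only [hsymm, hg, indicator_of_mem hz, indicator_of_mem (hsub hz), smul_smul]
      ring_nf
    · have h0 : bumpDensity (c • (z - w)) = 0 := by
        refine bumpDensity_eq_zero ?_
        rw [norm_smul, Real.norm_of_nonneg (by linarith)]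
        rw [mem_closedBall_iff_norm, not_le] at hz
        exact hcδ.trans (by gcongr)
      by_cases hz' : z ∈ slab (Icc s₁ s₂)
      · simp only [hsymm, h0, indicator_of_mem hz']
        simp
      · simp only [hsymm, h0, indicator_of_notMem hz']
        simp
  have hlim := tendsto_nhds_unique (tendsto_const_nhds.congr' (hconst.mono fun _ h => h.symm)) hpeak
  rw [hgw.eq_of_nhds] at hlim
  rw [← hlim, smul_smul]
  have : π ^ 4 / 3 * (3 / π ^ 4) = 1 := by field_simp
  rw [this, one_smul]

/-! ### Cauchy integrals of Hardy functions and their boundary limits. -/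

/-- The constant in `norm_cauchyKernel_le`. -/
def decayConst (δ : ℝ) : ℝ := (2 / min δ 1) ^ 5

theorem decayConst_pos {δ : ℝ} (hδ : 0 < δ) : 0 < decayConst δ := by
  unfold decayConst
  have : 0 < min δ 1 := lt_min hδ one_pos
  positivity

/-- In |u|⁻⁷ = |u|⁻² |u|⁻⁵, the first factor is bounded through the real part. The second uses that
|u| dominates both min(δ, 1) and min(δ, 1)|im u|, hence their average. -/
theorem norm_cauchyKernel_le {δ : ℝ} (hδ : 0 < δ) {u : Octonion} (hu : δ ≤ |u 0|) :
    ‖cauchyKernel u‖ ≤ (|u 0| ^ 2)⁻¹ * (decayConst δ * decay (im u)) := by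
  have hm : 0 < min δ 1 := lt_min hδ one_pos
  have h0 : 0 < |u 0| := hδ.trans_le hu
  have hre := abs_re_le_norm u
  have him := norm_im_le_norm u
  have hun : 0 < ‖u‖ := h0.trans_le hre
  have h1 : min δ 1 / 2 * (1 + ‖im u‖) ≤ ‖u‖ := by
    have h2 : min δ 1 ≤ ‖u‖ := (min_le_left _ _).trans (hu.trans hre)
    have h3 : min δ 1 * ‖im u‖ ≤ 1 * ‖u‖ := by
      gcongr
      exact min_le_right _ _
    linarith
  rw [norm_cauchyKernel]
  calc (‖u‖ ^ 7)⁻¹ = (‖u‖ ^ 2)⁻¹ * (‖u‖ ^ 5)⁻¹ := by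
        rw [← mul_inv]
        ring
    _ ≤ (|u 0| ^ 2)⁻¹ * ((min δ 1 / 2 * (1 + ‖im u‖)) ^ 5)⁻¹ := by gcongr
    _ = _ := by
        have : 1 + ‖im u‖ ≠ 0 := by positivity
        unfold decayConst decay
        field_simp

theorem norm_cauchyKernel_le_decay {δ : ℝ} (hδ : 0 < δ) {u : Octonion} (hu : δ ≤ |u 0|) :
    ‖cauchyKernel u‖ ≤ (δ ^ 2)⁻¹ * decayConst δ * decay (im u) := by
  refine (norm_cauchyKernel_le hδ hu).trans ?_
  rw [mul_assoc]
  have := decay_nonneg (im u)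
  have := (decayConst_pos hδ).le
  gcongr

theorem continuousAt_cauchyKernel {u : Octonion} (hu : u ≠ 0) : ContinuousAt cauchyKernel u :=
  (hasFDerivAt_cauchyKernel hu).continuousAt

theorem ne_zero_of_re_ne_zero {u : Octonion} (hu : u 0 ≠ 0) : u ≠ 0 := by
  rintro rfl
  exact hu rfl

theorem continuous_cauchyKernel_slice {s : ℝ} {w : Octonion} (hs : s ≠ w 0) :
    Continuous fun x => cauchyKernel (point s x - w) :=
  continuous_iff_continuousAt.2 fun _ =>
    (continuousAt_cauchyKernel (ne_zero_of_re_ne_zero (sub_ne_zero.2 hs))).comp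
      (f := fun x => point s x - w)
      ((continuous_point_right s).sub continuous_const).continuousAt

theorem LeftRegularOn.differentiableAt {I : Set ℝ} (hI : IsOpen I) {f : Octonion → Octonion}
    (hf : LeftRegularOn f (slab I)) {z : Octonion} (hz : z ∈ slab I) : DifferentiableAt ℝ f z :=
  hf.1.differentiableAt ((hI.preimage (by fun_prop : Continuous fun z : Octonion => z 0)).mem_nhds hz)

theorem MemHardy.memLp {I : Set ℝ} (hI : IsOpen I) {f : Octonion → Octonion} (hf : MemHardy I f)
    {s : ℝ} (hs : s ∈ I) : MemLp (fun x => f (point s x)) 2 volume := by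
  obtain ⟨C, hC⟩ := hf.bounded
  refine ⟨Continuous.aestronglyMeasurable ?_, (hC s hs).trans_lt ENNReal.coe_lt_top⟩
  exact continuous_iff_continuousAt.2 fun x =>
    (hf.leftRegularOn.differentiableAt hI (z := point s x) hs).continuousAt.comp
      (continuous_point_right s).continuousAt

theorem MemHardy.exists_bound {I : Set ℝ} (hI : IsOpen I) {f : Octonion → Octonion}
    (hf : MemHardy I f) : ∃ B : ℝ, ∀ s ∈ I, MemLp (fun x => f (point s x)) 2 volume ∧
      (eLpNorm (fun x => f (point s x)) 2 volume).toReal ≤ B := by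
  obtain ⟨C, hC⟩ := hf.bounded
  exact ⟨C, fun s hs => ⟨hf.memLp hI hs, ENNReal.toReal_le_coe_of_le_coe (hC s hs)⟩⟩

/-- The pairing of `f` with the Cauchy kernel centred at `w`, over the hyperplane `Re z = s`. -/
def cauchyPairing (w : Octonion) (f : Octonion → Octonion) (s : ℝ) : Octonion :=
  ∫ x, cauchyKernel (point s x - w) * f (point s x)

/-- The pairing splits into f - φ against the moving kernel, small by Cauchy–Schwarz, and the fixed
φ against the moving kernel, handled by dominated convergence. -/
theorem tendsto_cauchyPairing {I : Set ℝ} {t : ℝ} {f φ : Octonion → Octonion} {w : Octonion}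
    (hfI : ∀ s ∈ I, MemLp (fun x => f (point s x)) 2 volume)
    (hφ : MemLp (fun x => φ (point t x)) 2 volume)
    (hlim : Tendsto (fun s => eLpNorm (fun x => f (point s x) - φ (point t x)) 2 volume)
      (𝓝[I] t) (𝓝 0)) (hw : t ≠ w 0) :
    Tendsto (cauchyPairing w f) (𝓝[I] t) (𝓝 (cauchyPairing w φ t)) := by
  obtain ⟨δ, hδ, hδt⟩ : ∃ δ > 0, δ < |t - w 0| := exists_between (abs_pos.2 (sub_ne_zero.2 hw))
  have hev : ∀ᶠ s in 𝓝[I] t, s ∈ I ∧ δ < |s - w 0| := by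
    refine (eventually_mem_nhdsWithin (a := t) (s := I)).and (mem_nhdsWithin_of_mem_nhds ?_)
    exact ((by fun_prop : Continuous fun s => |s - w 0|).continuousAt).eventually (lt_mem_nhds hδt)
  set C := (δ ^ 2)⁻¹ * decayConst δ with hC
  have hC0 : 0 ≤ C := mul_nonneg (by positivity) (decayConst_pos hδ).le
  have hbound {s : ℝ} (hs : δ < |s - w 0|) (x : Imaginary) :
      ‖cauchyKernel (point s x - w)‖ ≤ C * decay (x - im w) :=
    norm_cauchyKernel_le_decay hδ (u := point s x - w) hs.le
  have hne {s : ℝ} (hs : δ < |s - w 0|) : s ≠ w 0 := by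
    rintro rfl
    simp only [sub_self, abs_zero] at hs
    linarith
  have h1 : Tendsto (fun s => ∫ x, cauchyKernel (point s x - w) * (f (point s x) - φ (point t x)))
      (𝓝[I] t) (𝓝 0) := by
    have hz : Tendsto (fun s => C * (decayNorm *
        (eLpNorm (fun x => f (point s x) - φ (point t x)) 2 volume).toReal)) (𝓝[I] t) (𝓝 0) := by
      have := (((ENNReal.tendsto_toReal ENNReal.zero_ne_top).comp hlim).const_mul
        decayNorm).const_mul C
      simpa using this
    refine squeeze_zero_norm' ?_ hz
    filter_upwards [hev] with s hs
    exact norm_integral_mul_le_of_decay (hbound hs.2) hC0 ((hfI s hs.1).sub hφ)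
  have h2 : Tendsto (fun s => ∫ x, cauchyKernel (point s x - w) * φ (point t x))
      (𝓝[I] t) (𝓝 (cauchyPairing w φ t)) := by
    refine tendsto_integral_filter_of_dominated_convergence
      (fun x => C * (decay (x - im w) * ‖φ (point t x)‖)) ?_ ?_
      ((integrable_decay_mul hφ _).const_mul C) (Eventually.of_forall fun x => ?_)
    · filter_upwards [hev] with s hs
      exact aestronglyMeasurable_mul
        (continuous_cauchyKernel_slice (hne hs.2)).aestronglyMeasurable hφ.1
    · filter_upwards [hev] with s hs
      refine Eventually.of_forall fun x => ?_
      rw [Octonion.norm_mul, ← mul_assoc]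
      gcongr
      exact hbound hs.2 x
    · have hcont : ContinuousAt (fun s : ℝ => cauchyKernel (point s x - w)) t :=
        (continuousAt_cauchyKernel (ne_zero_of_re_ne_zero (u := point t x - w)
          (sub_ne_zero.2 hw))).comp (f := fun s => point s x - w)
          (((continuous_point.comp (Continuous.prodMk_left x))).sub continuous_const).continuousAt
      exact ((mulL.flip (φ (point t x))).continuous.tendsto _).comp
        (hcont.tendsto.mono_left nhdsWithin_le_nhds)
  have h3 := h1.add h2
  rw [zero_add] at h3
  refine h3.congr' ?_
  filter_upwards [hev] with s hs
  have hm := (continuous_cauchyKernel_slice (hne hs.2)).aestronglyMeasurable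
    (μ := (volume : Measure Imaginary))
  have hi : Integrable (fun x => cauchyKernel (point s x - w) * (f (point s x) - φ (point t x)))
      volume := integrable_mul_of_decay hm (hbound hs.2) ((hfI s hs.1).sub hφ)
  rw [← integral_add hi (integrable_mul_of_decay hm (hbound hs.2) hφ)]
  refine integral_congr_ae (Eventually.of_forall fun x => ?_)
  simp only [← Octonion.mul_add, sub_add_cancel]

/-- The two powers not used by the decay weight give a factor (s - Re w)⁻², while the L² norms stay
bounded. -/
theorem tendsto_cauchyPairing_atTop {f : Octonion → Octonion} {w : Octonion} {B : ℝ}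
    (hf : ∀ s ∈ Ioi (0 : ℝ), MemLp (fun x => f (point s x)) 2 volume ∧
      (eLpNorm (fun x => f (point s x)) 2 volume).toReal ≤ B) :
    Tendsto (cauchyPairing w f) atTop (𝓝 0) := by
  have hz : Tendsto (fun s : ℝ => ((s - w 0) ^ 2)⁻¹ * decayConst 1 * (decayNorm * B)) atTop
      (𝓝 0) := by
    have h1 : Tendsto (fun s : ℝ => (s - w 0) ^ 2) atTop atTop :=
      (tendsto_pow_atTop two_ne_zero).comp (tendsto_atTop_add_const_right _ _ tendsto_id)
    have := (h1.inv_tendsto_atTop.mul_const (decayConst 1)).mul_const (decayNorm * B)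
    simpa using this
  refine squeeze_zero_norm' ?_ hz
  filter_upwards [eventually_gt_atTop 0, eventually_ge_atTop (w 0 + 1)] with s hs hsw
  have h1 : |s - w 0| = s - w 0 := abs_of_nonneg (by linarith)
  have hd := (decayConst_pos one_pos).le
  refine (norm_integral_mul_le_of_decay (C := ((s - w 0) ^ 2)⁻¹ * decayConst 1) (y := im w)
    (fun x => ?_) (by positivity) (hf s hs).1).trans ?_
  · have := norm_cauchyKernel_le one_pos (u := point s x - w)
      (show 1 ≤ |s - w 0| by rw [h1]; linarith)
    rw [mul_assoc, ← h1]
    exact this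
  · have := decayNorm_nonneg
    gcongr
    exact (hf s hs).2

theorem sub_eq_of_eventually_eventually {J : ℝ → Octonion} {l₁ l₂ : Filter ℝ} [l₁.NeBot] [l₂.NeBot]
    {a b c : Octonion} (h₁ : Tendsto J l₁ (𝓝 a)) (h₂ : Tendsto J l₂ (𝓝 b))
    (h : ∀ᶠ s₁ in l₁, ∀ᶠ s₂ in l₂, J s₂ - J s₁ = c) : b - a = c := by
  refine tendsto_nhds_unique (h₁.const_sub b) (tendsto_const_nhds.congr' ?_)
  filter_upwards [h] with s₁ hs₁
  exact tendsto_nhds_unique (tendsto_const_nhds.congr' (hs₁.mono fun _ h => h.symm))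
    (h₂.sub_const (J s₁))

theorem MemHardy.cauchyPairing_sub {I : Set ℝ} (hI : IsOpen I) {f : Octonion → Octonion}
    (hf : MemHardy I f) {s₁ s₂ : ℝ} (hsub : Icc s₁ s₂ ⊆ I) {w : Octonion} (hw : w 0 ∈ Ioo s₁ s₂) :
    cauchyPairing w f s₂ - cauchyPairing w f s₁ = (π ^ 4 / 3) • f w := by
  obtain ⟨B, hB⟩ := hf.exists_bound hI
  exact cauchy_formula_of_mem (fun z hz => hf.leftRegularOn.differentiableAt hI (hsub hz))
    (fun z hz => hf.leftRegularOn.2 z (hsub hz)) (fun s hs => hB s (hsub hs)) hw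

theorem MemHardy.cauchyPairing_sub_eq_zero {I : Set ℝ} (hI : IsOpen I) {f : Octonion → Octonion}
    (hf : MemHardy I f) {s₁ s₂ : ℝ} (hs : s₁ ≤ s₂) (hsub : Icc s₁ s₂ ⊆ I) {w : Octonion}
    (hw : w 0 ∉ Icc s₁ s₂) : cauchyPairing w f s₂ - cauchyPairing w f s₁ = 0 := by
  obtain ⟨B, hB⟩ := hf.exists_bound hI
  exact cauchy_formula_of_notMem hs (fun z hz => hf.leftRegularOn.differentiableAt hI (hsub hz))
    (fun z hz => hf.leftRegularOn.2 z (hsub hz)) (fun s hs => hB s (hsub hs)) hw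

theorem MemHardy.tendsto_cauchyPairing {I : Set ℝ} (hI : IsOpen I) {f φ : Octonion → Octonion}
    (hf : MemHardy I f) (hφ : HasBoundaryValue I f φ) {t : ℝ} (ht : t ∈ frontier I) {w : Octonion}
    (hw : t ≠ w 0) : Tendsto (cauchyPairing w f) (𝓝[I] t) (𝓝 (cauchyPairing w φ t)) :=
  Octonion.tendsto_cauchyPairing (fun _ hs => hf.memLp hI hs) (hφ t ht).1 (hφ t ht).2 hw

theorem zero_mem_frontier_Ioi : (0 : ℝ) ∈ frontier (Ioi (0 : ℝ)) := by simp

/-- The Cauchy formula for the Hardy space of the half-space. -/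
theorem MemHardy.cauchy_halfSpace {f φ : Octonion → Octonion} (hf : MemHardy (Ioi 0) f)
    (hφ : HasBoundaryValue (Ioi 0) f φ) {w : Octonion} (hw : 0 < w 0) :
    -cauchyPairing w φ 0 = (π ^ 4 / 3) • f w := by
  obtain ⟨B, hB⟩ := hf.exists_bound isOpen_Ioi
  rw [← zero_sub]
  refine sub_eq_of_eventually_eventually
    (hf.tendsto_cauchyPairing isOpen_Ioi hφ zero_mem_frontier_Ioi hw.ne)
    (tendsto_cauchyPairing_atTop hB) ?_
  filter_upwards [self_mem_nhdsWithin, mem_nhdsWithin_of_mem_nhds (Iio_mem_nhds hw)] with s₁ h₁ h₁w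
  filter_upwards [eventually_gt_atTop (w 0)] with s₂ h₂w
  exact hf.cauchyPairing_sub isOpen_Ioi (fun s hs => lt_of_lt_of_le h₁ hs.1) ⟨h₁w, h₂w⟩

theorem left_mem_frontier_Ioo {d : ℝ} (hd : 0 < d) : (0 : ℝ) ∈ frontier (Ioo 0 d) := by
  simp [frontier_Ioo hd]

theorem right_mem_frontier_Ioo {d : ℝ} (hd : 0 < d) : d ∈ frontier (Ioo 0 d) := by
  simp [frontier_Ioo hd]

/-- The Cauchy formula for the Hardy space of the strip. -/
theorem MemHardy.cauchy_strip {d : ℝ} (hd : 0 < d) {f φ : Octonion → Octonion}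
    (hf : MemHardy (Ioo 0 d) f) (hφ : HasBoundaryValue (Ioo 0 d) f φ) {w : Octonion}
    (hw : w 0 ∈ Ioo 0 d) :
    cauchyPairing w φ d - cauchyPairing w φ 0 = (π ^ 4 / 3) • f w := by
  have : (𝓝[Ioo 0 d] (0 : ℝ)).NeBot := left_nhdsWithin_Ioo_neBot hd
  have : (𝓝[Ioo 0 d] d).NeBot := right_nhdsWithin_Ioo_neBot hd
  refine sub_eq_of_eventually_eventually
    (hf.tendsto_cauchyPairing isOpen_Ioo hφ (left_mem_frontier_Ioo hd) hw.1.ne)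
    (hf.tendsto_cauchyPairing isOpen_Ioo hφ (right_mem_frontier_Ioo hd) hw.2.ne') ?_
  filter_upwards [self_mem_nhdsWithin, mem_nhdsWithin_of_mem_nhds (Iio_mem_nhds hw.1)]
    with s₁ h₁ h₁w
  filter_upwards [self_mem_nhdsWithin, mem_nhdsWithin_of_mem_nhds (Ioi_mem_nhds hw.2)]
    with s₂ h₂ h₂w
  exact hf.cauchyPairing_sub isOpen_Ioo
    (fun s hs => ⟨h₁.1.trans_le hs.1, hs.2.trans_lt h₂.2⟩) ⟨h₁w, h₂w⟩

theorem MemHardy.cauchy_strip_eq_zero {d : ℝ} (hd : 0 < d) {f φ : Octonion → Octonion}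
    (hf : MemHardy (Ioo 0 d) f) (hφ : HasBoundaryValue (Ioo 0 d) f φ) {w : Octonion}
    (hw : w 0 ∉ Icc 0 d) : cauchyPairing w φ d - cauchyPairing w φ 0 = 0 := by
  have : (𝓝[Ioo 0 d] (0 : ℝ)).NeBot := left_nhdsWithin_Ioo_neBot hd
  have : (𝓝[Ioo 0 d] d).NeBot := right_nhdsWithin_Ioo_neBot hd
  have hw0 : (0 : ℝ) ≠ w 0 := fun h => hw (h ▸ left_mem_Icc.2 hd.le)
  have hwd : d ≠ w 0 := fun h => hw (h ▸ right_mem_Icc.2 hd.le)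
  refine sub_eq_of_eventually_eventually
    (hf.tendsto_cauchyPairing isOpen_Ioo hφ (left_mem_frontier_Ioo hd) hw0)
    (hf.tendsto_cauchyPairing isOpen_Ioo hφ (right_mem_frontier_Ioo hd) hwd) ?_
  filter_upwards [self_mem_nhdsWithin] with s₁ h₁
  filter_upwards [self_mem_nhdsWithin, mem_nhdsWithin_of_mem_nhds (Ioi_mem_nhds h₁.2)]
    with s₂ h₂ h₁₂
  exact hf.cauchyPairing_sub_eq_zero isOpen_Ioo (le_of_lt h₁₂)
    (fun s hs => ⟨h₁.1.trans_le hs.1, hs.2.trans_lt h₂.2⟩)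
    fun h => hw ⟨h₁.1.le.trans h.1, h.2.trans h₂.2.le⟩

/-! ### Boundary values, the Hardy pairing and uniqueness. -/

theorem memLp_surfaceMeasure {I : Set ℝ} (hI : (frontier I).Finite) {φ : Octonion → Octonion}
    (hφ : ∀ t ∈ frontier I, MemLp (fun x => φ (point t x)) 2 volume) :
    MemLp φ 2 (surfaceMeasure I) := by
  have : Finite (frontier I) := hI
  constructor
  · refine AEStronglyMeasurable.sum_measure fun t => ?_
    exact (measurableEmbedding_point t).aestronglyMeasurable_map_iff.2 (hφ t t.2).1
  · rw [eLpNorm_lt_top_iff_lintegral_rpow_enorm_lt_top two_ne_zero ENNReal.ofNat_ne_top,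
      surfaceMeasure, lintegral_sum_measure]
    have := Fintype.ofFinite (frontier I)
    rw [tsum_fintype]
    refine ENNReal.sum_lt_top.2 fun t _ => ?_
    rw [(measurableEmbedding_point t).lintegral_map]
    exact (eLpNorm_lt_top_iff_lintegral_rpow_enorm_lt_top two_ne_zero ENNReal.ofNat_ne_top).1
      (hφ t t.2).2

theorem HasBoundaryValue.memLp {I : Set ℝ} (hI : (frontier I).Finite) {f φ : Octonion → Octonion}
    (h : HasBoundaryValue I f φ) : MemLp φ 2 (surfaceMeasure I) :=
  memLp_surfaceMeasure hI fun t ht => (h t ht).1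

theorem integrable_conj_mul {α : Type*} [MeasurableSpace α] {μ : Measure α}
    {φ ψ : α → Octonion} (hφ : MemLp φ 2 μ) (hψ : MemLp ψ 2 μ) :
    Integrable (fun x => conj (ψ x) * φ x) μ := by
  have hc : AEStronglyMeasurable (fun x => conj (ψ x)) μ :=
    conjL.continuous.comp_aestronglyMeasurable hψ.1
  refine (hψ.norm.integrable_mul hφ.norm).mono' (aestronglyMeasurable_mul hc hφ.1)
    (Eventually.of_forall fun x => ?_)
  rw [Octonion.norm_mul, norm_conj]
  rfl

theorem hardyInner_eq_tsum {I : Set ℝ} (hI : (frontier I).Finite) {φ ψ : Octonion → Octonion}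
    (hφ : ∀ t ∈ frontier I, MemLp (fun x => φ (point t x)) 2 volume)
    (hψ : ∀ t ∈ frontier I, MemLp (fun x => ψ (point t x)) 2 volume) :
    hardyInner I φ ψ =
      (3 / π ^ 4) • ∑' t : frontier I, ∫ x, conj (ψ (point t x)) * φ (point t x) := by
  rw [hardyInner, surfaceMeasure, integral_sum_measure]
  · congr 2
    funext t
    exact (measurableEmbedding_point t).integral_map _
  · exact integrable_conj_mul (memLp_surfaceMeasure hI hφ) (memLp_surfaceMeasure hI hψ)

theorem neBot_of_mem_frontier {I : Set ℝ} {t : ℝ} (ht : t ∈ frontier I) : (𝓝[I] t).NeBot :=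
  mem_closure_iff_nhdsWithin_neBot.1 (frontier_subset_closure ht)

/-- Uniqueness of L² limits on each face. It frees the reproducing formula from the choice of
boundary value. -/
theorem HasBoundaryValue.ae_eq {I : Set ℝ} (hI : (frontier I).Finite)
    {f φ φ' : Octonion → Octonion}
    (hf : ∀ s ∈ I, AEStronglyMeasurable (fun x => f (point s x)) volume)
    (h : HasBoundaryValue I f φ) (h' : HasBoundaryValue I f φ') :
    φ =ᵐ[surfaceMeasure I] φ' := by
  have : Countable (frontier I) := hI.countable
  rw [EventuallyEq, surfaceMeasure, Measure.ae_sum_iff]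
  intro t
  rw [(measurableEmbedding_point t).ae_map_iff]
  have := neBot_of_mem_frontier t.2
  have hm := (h t t.2).1.1
  have hm' := (h' t t.2).1.1
  have hle : ∀ᶠ s in 𝓝[I] (t : ℝ),
      eLpNorm (fun x => φ (point t x) - φ' (point t x)) 2 volume ≤
      eLpNorm (fun x => f (point s x) - φ (point t x)) 2 volume +
        eLpNorm (fun x => f (point s x) - φ' (point t x)) 2 volume := by
    filter_upwards [self_mem_nhdsWithin] with s hs
    have h1 := eLpNorm_sub_le ((hf s hs).sub hm') ((hf s hs).sub hm) (p := 2) one_le_two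
    rw [add_comm]
    refine le_trans (le_of_eq ?_) h1
    congr 1
    funext x
    simp
  have hlim := (h t t.2).2.add (h' t t.2).2
  rw [add_zero] at hlim
  have h0 : eLpNorm (fun x => φ (point t x) - φ' (point t x)) 2 volume = 0 :=
    le_antisymm (ge_of_tendsto hlim hle) zero_le
  filter_upwards [(eLpNorm_eq_zero_iff (hm.sub hm') two_ne_zero).1 h0] with x hx
  exact sub_eq_zero.1 hx

theorem hardyInner_congr_right {I : Set ℝ} {φ κ κ' : Octonion → Octonion}
    (h : κ =ᵐ[surfaceMeasure I] κ') : hardyInner I φ κ = hardyInner I φ κ' := by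
  rw [hardyInner, hardyInner]
  congr 1
  refine integral_congr_ae ?_
  filter_upwards [h] with z hz
  rw [hz]

theorem HasBoundaryValue.sub {I : Set ℝ} {f g φ γ : Octonion → Octonion}
    (hf : ∀ s ∈ I, AEStronglyMeasurable (fun x => f (point s x)) volume)
    (hg : ∀ s ∈ I, AEStronglyMeasurable (fun x => g (point s x)) volume)
    (hφ : HasBoundaryValue I f φ) (hγ : HasBoundaryValue I g γ) :
    HasBoundaryValue I (fun z => f z - g z) (fun z => φ z - γ z) := by
  intro t ht
  refine ⟨(hφ t ht).1.sub (hγ t ht).1, ?_⟩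
  have hlim := (hφ t ht).2.add (hγ t ht).2
  rw [add_zero] at hlim
  refine tendsto_of_tendsto_of_tendsto_of_le_of_le' tendsto_const_nhds hlim
    (Eventually.of_forall fun _ => zero_le) ?_
  filter_upwards [self_mem_nhdsWithin] with s hs
  have h1 := eLpNorm_sub_le ((hf s hs).sub (hφ t ht).1.1) ((hg s hs).sub (hγ t ht).1.1)
    (p := 2) one_le_two
  refine le_trans (le_of_eq ?_) h1
  congr 1
  funext x
  simp only [Pi.sub_apply]
  abel

theorem LeftRegularOn.sub {I : Set ℝ} (hI : IsOpen I) {f g : Octonion → Octonion}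
    (hf : LeftRegularOn f (slab I)) (hg : LeftRegularOn g (slab I)) :
    LeftRegularOn (fun z => f z - g z) (slab I) := by
  refine ⟨hf.1.sub hg.1, fun z hz => ?_⟩
  have h : fderiv ℝ (fun z => f z - g z) z = fderiv ℝ f z - fderiv ℝ g z :=
    fderiv_fun_sub (hf.differentiableAt hI hz) (hg.differentiableAt hI hz)
  have h1 := hf.2 z hz
  have h2 := hg.2 z hz
  unfold cauchyRiemann at h1 h2 ⊢
  simp only [h, _root_.sub_apply, Octonion.mul_sub, Finset.sum_sub_distrib, h1, h2, sub_self]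

theorem MemHardy.sub {I : Set ℝ} (hI : IsOpen I) {f g : Octonion → Octonion}
    (hf : MemHardy I f) (hg : MemHardy I g) : MemHardy I (fun z => f z - g z) := by
  refine ⟨hf.leftRegularOn.sub hI hg.leftRegularOn, ?_, ?_⟩
  · obtain ⟨C, hC⟩ := hf.bounded
    obtain ⟨D, hD⟩ := hg.bounded
    refine ⟨C + D, fun s hs => ?_⟩
    rw [ENNReal.coe_add]
    exact (eLpNorm_sub_le (hf.memLp hI hs).1 (hg.memLp hI hs).1 one_le_two).trans
      (add_le_add (hC s hs) (hD s hs))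
  · obtain ⟨φ, hφ⟩ := hf.exists_boundaryValue
    obtain ⟨γ, hγ⟩ := hg.exists_boundaryValue
    exact ⟨_, hφ.sub (fun s hs => (hf.memLp hI hs).1) (fun s hs => (hg.memLp hI hs).1) hγ⟩

theorem HasBoundaryValue.congr {I : Set ℝ} {f g φ : Octonion → Octonion}
    (h : HasBoundaryValue I f φ) (hfg : ∀ z ∈ slab I, f z = g z) : HasBoundaryValue I g φ := by
  refine fun t ht => ⟨(h t ht).1, (h t ht).2.congr' ?_⟩
  filter_upwards [self_mem_nhdsWithin] with s hs
  congr 1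
  funext x
  rw [hfg (point s x) hs]

theorem isOpen_slab {I : Set ℝ} (hI : IsOpen I) : IsOpen (slab I) :=
  hI.preimage (by fun_prop : Continuous fun z : Octonion => z 0)

theorem MemHardy.congr {I : Set ℝ} (hI : IsOpen I) {f g : Octonion → Octonion}
    (h : MemHardy I f) (hfg : ∀ z ∈ slab I, f z = g z) : MemHardy I g := by
  refine ⟨⟨h.leftRegularOn.1.congr fun z hz => (hfg z hz).symm, fun z hz => ?_⟩, ?_, ?_⟩
  · have : f =ᶠ[𝓝 z] g := by
      filter_upwards [(isOpen_slab hI).mem_nhds hz] with x hx using hfg x hx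
    rw [cauchyRiemann, ← this.fderiv_eq]
    exact h.leftRegularOn.2 z hz
  · obtain ⟨C, hC⟩ := h.bounded
    refine ⟨C, fun s hs => ?_⟩
    have : (fun x => g (point s x)) = fun x => f (point s x) :=
      funext fun x => (hfg (point s x) hs).symm
    rw [this]
    exact hC s hs
  · obtain ⟨φ, hφ⟩ := h.exists_boundaryValue
    exact ⟨φ, hφ.congr hfg⟩

theorem hardyInner_sub_right {I : Set ℝ} {φ κ κ' : Octonion → Octonion}
    (hφ : MemLp φ 2 (surfaceMeasure I)) (hκ : MemLp κ 2 (surfaceMeasure I))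
    (hκ' : MemLp κ' 2 (surfaceMeasure I)) :
    hardyInner I φ (fun z => κ z - κ' z) = hardyInner I φ κ - hardyInner I φ κ' := by
  rw [hardyInner, hardyInner, hardyInner, ← smul_sub,
    ← integral_sub (integrable_conj_mul hφ hκ) (integrable_conj_mul hφ hκ')]
  simp only [conj_sub, Octonion.sub_mul]

/-- Since conj γ γ = |γ|², the octonion-valued pairing of γ with itself is a positive real multiple
of its squared L² norm. -/
theorem ae_eq_zero_of_hardyInner_self {I : Set ℝ} {γ : Octonion → Octonion}
    (hγ : MemLp γ 2 (surfaceMeasure I)) (h : hardyInner I γ γ = 0) :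
    γ =ᵐ[surfaceMeasure I] 0 := by
  have hint : Integrable (fun z => ‖γ z‖ ^ 2) (surfaceMeasure I) :=
    (memLp_two_iff_integrable_sq_norm hγ.1).1 hγ
  have he : e 0 ≠ 0 := by simp [e]
  simp only [hardyInner, conj_mul_self] at h
  rw [integral_smul_const, smul_smul, smul_eq_zero_iff_left he, mul_eq_zero_iff_left
    (by positivity), integral_eq_zero_iff_of_nonneg (fun z => by positivity) hint] at h
  filter_upwards [h] with z hz
  simpa using hz

theorem hardyInner_of_ae_eq_zero {I : Set ℝ} {φ κ : Octonion → Octonion}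
    (h : φ =ᵐ[surfaceMeasure I] 0) : hardyInner I φ κ = 0 := by
  rw [hardyInner, integral_eq_zero_of_ae, smul_zero]
  filter_upwards [h] with z hz
  rw [hz]
  exact Octonion.mul_zero _

/-- A Szegő kernel is unique. -/
theorem IsSzegoKernel.eq {I : Set ℝ} (hI : IsOpen I) (hfin : (frontier I).Finite)
    {K S : Octonion → Octonion → Octonion} (hK : IsSzegoKernel I K) (hS : IsSzegoKernel I S)
    {z w : Octonion} (hz : z ∈ slab I) (hw : w ∈ slab I) : K z w = S z w := by
  have hKw := (hK w hw).1
  have hSw := (hS w hw).1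
  obtain ⟨κ, hκ⟩ := hKw.exists_boundaryValue
  obtain ⟨σ, hσ⟩ := hSw.exists_boundaryValue
  obtain ⟨τ, hτ⟩ := (hS z hz).1.exists_boundaryValue
  have hg := hKw.sub hI hSw
  have hγ := hκ.sub (fun s hs => (hKw.memLp hI hs).1) (fun s hs => (hSw.memLp hI hs).1) hσ
  have hγm := hγ.memLp hfin
  -- Pairing g = K(·, w) - S(·, w) with either kernel returns g(w), and the two values cancel.
  have h0 : hardyInner I (fun z => κ z - σ z) (fun z => κ z - σ z) = 0 := by
    rw [hardyInner_sub_right hγm (hκ.memLp hfin) (hσ.memLp hfin),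
      ← (hK w hw).2 _ hg _ κ hγ hκ, ← (hS w hw).2 _ hg _ σ hγ hσ, sub_self]
  -- The kernel at z now recovers g(z) from a boundary value that is zero almost everywhere.
  have h1 := (hS z hz).2 _ hg _ τ hγ hτ
  rw [hardyInner_of_ae_eq_zero (ae_eq_zero_of_hardyInner_self hγm h0)] at h1
  exact sub_eq_zero.1 h1

/-- The converse holds because Hardy membership and boundary values depend only on the values inside
the domain. -/
theorem isSzegoKernel_iff {I : Set ℝ} (hI : IsOpen I) (hfin : (frontier I).Finite)
    {S : Octonion → Octonion → Octonion} (hS : IsSzegoKernel I S)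
    (K : Octonion → Octonion → Octonion) :
    IsSzegoKernel I K ↔ ∀ z ∈ slab I, ∀ w ∈ slab I, K z w = S z w := by
  refine ⟨fun hK z hz w hw => hK.eq hI hfin hS hz hw, fun h w hw => ⟨?_, ?_⟩⟩
  · exact (hS w hw).1.congr hI fun z hz => (h z hz w hw).symm
  · intro f hf φ κ hφ hκ
    exact (hS w hw).2 f hf φ κ hφ (hκ.congr fun z hz => h z hz w hw)

/-- A function that is continuous on the closed slab and dominated by a square-integrable weight
is its own boundary value. -/
theorem hasBoundaryValue_self {I : Set ℝ} {f : Octonion → Octonion} {C : ℝ} {y : Imaginary}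
    (hf : ContinuousOn f (slab (closure I)))
    (hfC : ∀ z ∈ slab (closure I), ‖f z‖ ≤ C * decay (im z - y)) :
    (∀ s ∈ closure I, MemLp (fun x => f (point s x)) 2 volume) ∧ HasBoundaryValue I f f := by
  have hcont {s : ℝ} (hs : s ∈ closure I) : Continuous fun x => f (point s x) :=
    hf.comp_continuous (continuous_point_right s) fun _ => hs
  have hmem {s : ℝ} (hs : s ∈ closure I) : MemLp (fun x => f (point s x)) 2 volume :=
    ((memLp_decay_sub y).const_mul C).mono' (hcont hs).aestronglyMeasurable
      (Eventually.of_forall fun x => hfC (point s x) hs)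
  refine ⟨fun s hs => hmem hs, fun t ht => ?_⟩
  have htc := frontier_subset_closure ht
  refine ⟨hmem htc, ?_⟩
  have hb : MemLp (fun x => 2 * C * decay (x - y)) 2 volume := (memLp_decay_sub y).const_mul _
  have hI : ∀ᶠ s in 𝓝[I] t, s ∈ closure I := by
    filter_upwards [self_mem_nhdsWithin] with s hs using subset_closure hs
  have key : Tendsto (fun s => ∫⁻ x, ‖f (point s x) - f (point t x)‖ₑ ^ (2 : ℝ)) (𝓝[I] t)
      (𝓝 (∫⁻ _ : Imaginary, 0)) := by
    refine tendsto_lintegral_filter_of_dominated_convergence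
      (fun x => ‖2 * C * decay (x - y)‖ₑ ^ (2 : ℝ)) ?_ ?_ ?_ ?_
    · filter_upwards [hI] with s hs
      exact (((hcont hs).sub (hcont htc)).enorm.measurable).pow_const _
    · filter_upwards [hI] with s hs
      refine Eventually.of_forall fun x => ?_
      gcongr
      rw [enorm_le_iff_norm_le]
      refine (norm_sub_le _ _).trans (le_trans ?_ (le_abs_self _))
      have h1 := hfC (point s x) hs
      have h2 := hfC (point t x) htc
      rw [im_point] at h1 h2
      linarith
    · have := (eLpNorm_lt_top_iff_lintegral_rpow_enorm_lt_top two_ne_zero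
        ENNReal.ofNat_ne_top).1 hb.2
      simpa using this.ne
    · refine Eventually.of_forall fun x => ?_
      have hx : Tendsto (fun s => f (point s x)) (𝓝[I] t) (𝓝 (f (point t x))) := by
        refine (hf (point t x) htc).tendsto.comp ?_
        refine tendsto_nhdsWithin_iff.2 ⟨?_, hI⟩
        exact ((continuous_point.comp (Continuous.prodMk_left x)).tendsto t).mono_left
          nhdsWithin_le_nhds
      have h0 := (((hx.sub_const (f (point t x))).enorm).ennrpow_const 2)
      simpa using h0
  have key2 := key.ennrpow_const (1 / 2)
  have hz : (∫⁻ _ : Imaginary, (0 : ℝ≥0∞)) ^ ((1 : ℝ) / 2) = 0 := by simp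
  rw [hz] at key2
  refine key2.congr fun s => ?_
  rw [eLpNorm_eq_lintegral_rpow_enorm_toReal two_ne_zero ENNReal.ofNat_ne_top]
  simp

theorem memHardy_of_dominated {I : Set ℝ} {f : Octonion → Octonion} {C : ℝ} (hC : 0 ≤ C)
    {y : Imaginary} (hreg : LeftRegularOn f (slab I)) (hf : ContinuousOn f (slab (closure I)))
    (hfC : ∀ z ∈ slab (closure I), ‖f z‖ ≤ C * decay (im z - y)) : MemHardy I f := by
  refine ⟨hreg, ?_, f, (hasBoundaryValue_self hf hfC).2⟩
  refine ⟨(eLpNorm (fun x => C * decay (x - y)) 2 volume).toNNReal, fun s hs => ?_⟩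
  rw [ENNReal.coe_toNNReal ((memLp_decay_sub y).const_mul C).2.ne]
  refine eLpNorm_mono fun x => ?_
  rw [Real.norm_of_nonneg (mul_nonneg hC (decay_nonneg _))]
  exact hfC (point s x) (subset_closure hs)

/-- Criterion for a kernel that extends continuously to the closed slab to be a Szegő kernel. -/
theorem isSzegoKernel_of_dominated {I : Set ℝ} (hI : IsOpen I) (hfin : (frontier I).Finite)
    {S : Octonion → Octonion → Octonion}
    (hreg : ∀ w ∈ slab I, LeftRegularOn (fun z => S z w) (slab I))
    (hcont : ∀ w ∈ slab I, ContinuousOn (fun z => S z w) (slab (closure I)))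
    (hbound : ∀ w ∈ slab I, ∃ C, 0 ≤ C ∧ ∀ z ∈ slab (closure I),
      ‖S z w‖ ≤ C * decay (im z - im w))
    (hrep : ∀ w ∈ slab I, ∀ f φ : Octonion → Octonion, MemHardy I f → HasBoundaryValue I f φ →
      f w = (3 / π ^ 4) • ∑' t : frontier I, ∫ x, conj (S (point t x) w) * φ (point t x)) :
    IsSzegoKernel I S := by
  intro w hw
  obtain ⟨C, hC, hSC⟩ := hbound w hw
  have hS := memHardy_of_dominated hC (hreg w hw) (hcont w hw) hSC
  have hbv := (hasBoundaryValue_self (hcont w hw) hSC).2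
  refine ⟨hS, fun f hf φ κ hφ hκ => ?_⟩
  rw [hrep w hw f φ hf hφ, ← hardyInner_eq_tsum (ψ := fun z => S z w) hfin
    (fun t ht => (hφ t ht).1) (fun t ht => (hbv t ht).1)]
  exact hardyInner_congr_right (hbv.ae_eq hfin (fun s hs => (hS.memLp hI hs).1) hκ)

/-! ### The half-space kernel. -/

theorem cauchyRiemann_eq {f : Octonion → Octonion} {f' : Octonion →L[ℝ] Octonion} {z : Octonion}
    (h : HasFDerivAt f f' z) : cauchyRiemann f z = ∑ i, e i * f' (e i) := by
  rw [cauchyRiemann, h.fderiv]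

/-- The derivative of the Cauchy kernel. -/
def cauchyKernelFDeriv (u : Octonion) : Octonion →L[ℝ] Octonion :=
  radialFDeriv (‖u‖ ^ 8)⁻¹ (-4 * (‖u‖ ^ 10)⁻¹) u

theorem hasFDerivAt_cauchyKernel_add {z v : Octonion} (h : z + v ≠ 0) :
    HasFDerivAt (fun z => cauchyKernel (z + v)) (cauchyKernelFDeriv (z + v)) z := by
  have h1 : HasFDerivAt (fun z => z + v) (ContinuousLinearMap.id ℝ Octonion) z :=
    (hasFDerivAt_id z).add_const v
  exact HasFDerivAt.comp (f := fun z => z + v) z (hasFDerivAt_cauchyKernel h) h1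

theorem cauchyKernel_eq_of_conj {u v : Octonion} (h : conj u = v) :
    (‖v‖ ^ 8)⁻¹ • v = cauchyKernel u := by
  rw [cauchyKernel, ← h, norm_conj]

/-- On Re z = t conjugation is z ↦ 2t - z. The pole -conj w - c is thereby reflected in that
hyperplane to w + c + 2t, and oddness of the Cauchy kernel gives the sign. -/
theorem conj_cauchyKernel_point (t c : ℝ) (x : Imaginary) (w : Octonion) :
    conj (cauchyKernel (point t x + conj w + c • e 0)) =
      -cauchyKernel (point t x - (w + (c + 2 * t) • e 0)) := by
  have h : point t x - (w + (c + 2 * t) • e 0) = -conj (point t x + conj w + c • e 0) := by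
    have h1 : conj (point t x) = (2 * t) • e 0 - point t x := by
      rw [conj_point, smul_e_zero, point_sub]
      congr 1
      · ring
      · simp
    rw [conj_add, conj_add, conj_conj, conj_smul, conj_e_zero, h1, add_smul]
    abel
  rw [h, conj_cauchyKernel, cauchyKernel, norm_neg, norm_conj, conj_neg, conj_conj, smul_neg,
    neg_neg]

theorem im_add_conj_add (z w : Octonion) (c : ℝ) : im (z + conj w + c • e 0) = im z - im w := by
  rw [← point_im z, ← point_im w, conj_point, smul_e_zero, point_add, point_add, im_point, im_point,
    im_point]
  abel

theorem re_add_conj_add (z w : Octonion) (c : ℝ) : (z + conj w + c • e 0) 0 = z 0 + w 0 + c := by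
  simp [conj, e]

theorem re_add_conj (z w : Octonion) : (z + conj w) 0 = z 0 + w 0 := by
  simp [conj]

theorem im_add_conj (z w : Octonion) : im (z + conj w) = im z - im w := by
  simpa using im_add_conj_add z w 0

theorem halfSpace_rep {f φ : Octonion → Octonion} (hf : MemHardy (Ioi 0) f)
    (hφ : HasBoundaryValue (Ioi 0) f φ) {w : Octonion} (hw : w ∈ slab (Ioi 0)) :
    f w = (3 / π ^ 4) • ∑' t : frontier (Ioi (0 : ℝ)),
      ∫ x, conj (cauchyKernel (point t x + conj w)) * φ (point t x) := by
  have hconj (x : Imaginary) :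
      conj (cauchyKernel (point 0 x + conj w)) = -cauchyKernel (point 0 x - w) := by
    simpa using conj_cauchyKernel_point 0 0 x w
  rw [frontier_Ioi, tsum_singleton (0 : ℝ)
    (fun t : ℝ => ∫ x, conj (cauchyKernel (point t x + conj w)) * φ (point t x))]
  simp only [hconj, Octonion.neg_mul, integral_neg]
  have h := hf.cauchy_halfSpace hφ hw
  rw [cauchyPairing] at h
  rw [h, smul_smul]
  have : 3 / π ^ 4 * (π ^ 4 / 3) = 1 := by field_simp
  rw [this, one_smul]

theorem finite_frontier_Ioi : (frontier (Ioi (0 : ℝ))).Finite := by simp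

/-- The Szegő kernel of the half-space. -/
theorem isSzegoKernel_halfSpace :
    IsSzegoKernel (Ioi 0) fun z w => cauchyKernel (z + conj w) := by
  have hre {z w : Octonion} (hz : z ∈ slab (closure (Ioi 0))) (_ : w ∈ slab (Ioi 0)) :
      w 0 ≤ (z + conj w) 0 := by
    rw [closure_Ioi] at hz
    have : (0 : ℝ) ≤ z 0 := hz
    rw [re_add_conj]
    linarith
  have hne {z w : Octonion} (hz : z ∈ slab (closure (Ioi 0))) (hw : w ∈ slab (Ioi 0)) :
      z + conj w ≠ 0 :=
    ne_zero_of_re_ne_zero (lt_of_lt_of_le hw (hre hz hw)).ne'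
  refine isSzegoKernel_of_dominated isOpen_Ioi finite_frontier_Ioi (fun w hw => ⟨fun z hz => ?_,
    fun z hz => ?_⟩) (fun w hw z hz => ?_) (fun w hw => ?_) fun w hw f φ hf hφ => ?_
  · have hz' : z ∈ slab (closure (Ioi 0)) := subset_closure hz
    exact (hasFDerivAt_cauchyKernel_add (hne hz' hw)).differentiableAt.differentiableWithinAt
  · have hz' : z ∈ slab (closure (Ioi 0)) := subset_closure hz
    rw [cauchyRiemann_eq (hasFDerivAt_cauchyKernel_add (hne hz' hw))]
    exact sum_mul_fderiv_cauchyKernel (hne hz' hw)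
  · exact (hasFDerivAt_cauchyKernel_add (hne hz hw)).continuousAt.continuousWithinAt
  · have hw0 : 0 < w 0 := hw
    refine ⟨(w 0 ^ 2)⁻¹ * decayConst (w 0), mul_nonneg (by positivity) (decayConst_pos hw0).le,
      fun z hz => ?_⟩
    rw [← im_add_conj]
    exact norm_cauchyKernel_le_decay hw0 ((hre hz hw).trans (le_abs_self _))
  · exact halfSpace_rep hf hφ hw

/-! ### The strip kernel. -/

theorem summable_inv_abs_add_one_sq : Summable fun n : ℤ => ((|(n : ℝ)| + 1) ^ 2)⁻¹ := by
  have h : Summable fun n : ℕ => (((n : ℝ) + 1) ^ 2)⁻¹ := by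
    have := (summable_nat_add_iff 1).2 (Real.summable_nat_pow_inv.2 one_lt_two)
    simpa using this
  refine Summable.of_nat_of_neg (h.congr fun n => ?_) (h.congr fun n => ?_)
  · simp
  · simp

/-- The summand of the Szegő kernel of the strip. -/
def stripTerm (d : ℝ) (w : Octonion) (n : ℤ) (z : Octonion) : Octonion :=
  (-1 : ℝ) ^ n • cauchyKernel (z + conj w + (2 * d * n) • e 0)

theorem stripTerm_eq (d : ℝ) (w : Octonion) (n : ℤ) (z : Octonion) :
    stripTerm d w n z = ((-1 : ℝ) ^ n * (‖conj z + w + (2 * d * n) • e 0‖ ^ 8)⁻¹) •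
      (conj z + w + (2 * d * n) • e 0) := by
  have h : conj (z + conj w + (2 * d * n) • e 0) = conj z + w + (2 * d * n) • e 0 := by
    rw [conj_add, conj_add, conj_conj, conj_smul, conj_e_zero]
  rw [stripTerm, ← cauchyKernel_eq_of_conj h, smul_smul]

theorem norm_stripTerm (d : ℝ) (w : Octonion) (n : ℤ) (z : Octonion) :
    ‖stripTerm d w n z‖ = ‖cauchyKernel (z + conj w + (2 * d * n) • e 0)‖ := by
  rw [stripTerm, norm_smul, Real.norm_eq_abs, abs_neg_one_zpow, one_mul]

/-- For n ≥ 0 the right side is at least a + 2dn; for n < 0 it is at least (d - a) + 2d(|n| - 1).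
The halving of the minimum is forced by n = -1, where |n| + 1 = 2. -/
theorem strip_gap {d a s : ℝ} (ha : a ∈ Ioo 0 d) (hs : s ∈ Icc 0 d) (n : ℤ) :
    min a (d - a) / 2 * (|(n : ℝ)| + 1) ≤ |s + a + 2 * d * n| := by
  set c := min a (d - a) / 2 with hc
  have hc1 : 2 * c ≤ a := by
    have := min_le_left a (d - a)
    linarith
  have hc2 : 2 * c ≤ d - a := by
    have := min_le_right a (d - a)
    linarith
  have hc0 : 0 < c := half_pos (lt_min ha.1 (sub_pos.2 ha.2))
  rcases le_or_gt 0 n with hn | hn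
  · have hn' : (0 : ℝ) ≤ n := by exact_mod_cast hn
    rw [abs_of_nonneg hn']
    refine le_trans ?_ (le_abs_self _)
    nlinarith [hs.1]
  · have hn' : (n : ℝ) ≤ -1 := by exact_mod_cast (by omega : n ≤ -1)
    rw [abs_of_nonpos (by linarith)]
    refine le_trans ?_ (neg_le_abs _)
    nlinarith [hs.2]

section Strip

variable {d : ℝ} {w : Octonion}

/-- Half the distance from `Re w` to the boundary of `(0, d)`. -/
def gap (d : ℝ) (w : Octonion) : ℝ := min (w 0) (d - w 0) / 2

theorem gap_pos (hw : w ∈ slab (Ioo 0 d)) : 0 < gap d w :=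
  half_pos (lt_min hw.1 (sub_pos.2 hw.2))

theorem gap_mul_le (hw : w ∈ slab (Ioo 0 d)) {z : Octonion} (hz : z ∈ slab (Icc 0 d)) (n : ℤ) :
    gap d w * (|(n : ℝ)| + 1) ≤ |(z + conj w + (2 * d * n) • e 0) 0| := by
  rw [re_add_conj_add]
  exact strip_gap hw hz n

theorem gap_le (hw : w ∈ slab (Ioo 0 d)) {z : Octonion} (hz : z ∈ slab (Icc 0 d)) (n : ℤ) :
    gap d w ≤ |(z + conj w + (2 * d * n) • e 0) 0| := by
  refine le_trans ?_ (gap_mul_le hw hz n)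
  nlinarith [gap_pos hw, abs_nonneg (n : ℝ)]

theorem strip_ne_zero (hw : w ∈ slab (Ioo 0 d)) {z : Octonion} (hz : z ∈ slab (Icc 0 d)) (n : ℤ) :
    z + conj w + (2 * d * n) • e 0 ≠ 0 :=
  ne_zero_of_re_ne_zero (abs_pos.1 ((gap_pos hw).trans_le (gap_le hw hz n)))

/-- The constant in `norm_stripTerm_le`. -/
def stripConst (d : ℝ) (w : Octonion) : ℝ := (gap d w ^ 2)⁻¹ * decayConst (gap d w)

theorem stripConst_nonneg (hw : w ∈ slab (Ioo 0 d)) : 0 ≤ stripConst d w :=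
  mul_nonneg (by positivity) (decayConst_pos (gap_pos hw)).le

theorem norm_stripTerm_le (hw : w ∈ slab (Ioo 0 d)) {z : Octonion} (hz : z ∈ slab (Icc 0 d))
    (n : ℤ) : ‖stripTerm d w n z‖ ≤
      ((|(n : ℝ)| + 1) ^ 2)⁻¹ * (stripConst d w * decay (im z - im w)) := by
  have hg := gap_pos hw
  have hd := decayConst_pos hg
  have hdec := decay_nonneg (im z - im w)
  rw [norm_stripTerm]
  refine (norm_cauchyKernel_le hg (gap_le hw hz n)).trans ?_
  rw [im_add_conj_add]
  calc _ ≤ ((gap d w * (|(n : ℝ)| + 1)) ^ 2)⁻¹ * (decayConst (gap d w) * decay (im z - im w)) := by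
        gcongr
        exact gap_mul_le hw hz n
    _ = _ := by
        rw [stripConst, mul_pow, mul_inv]
        ring

theorem decay_le_one (x : Imaginary) : decay x ≤ 1 :=
  inv_le_one_of_one_le₀ (one_le_pow₀ (by linarith [norm_nonneg x]))

theorem norm_stripTerm_le_const (hw : w ∈ slab (Ioo 0 d)) {z : Octonion} (hz : z ∈ slab (Icc 0 d))
    (n : ℤ) : ‖stripTerm d w n z‖ ≤ ((|(n : ℝ)| + 1) ^ 2)⁻¹ * stripConst d w := by
  refine (norm_stripTerm_le hw hz n).trans ?_
  have := stripConst_nonneg hw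
  gcongr
  exact mul_le_of_le_one_right this (decay_le_one _)

theorem summable_stripTerm (hw : w ∈ slab (Ioo 0 d)) {z : Octonion} (hz : z ∈ slab (Icc 0 d)) :
    Summable fun n => stripTerm d w n z :=
  Summable.of_norm_bounded (summable_inv_abs_add_one_sq.mul_right _)
    (norm_stripTerm_le_const hw hz)

/-- The Szegő kernel of the strip. -/
def stripKernel (d : ℝ) (z w : Octonion) : Octonion := ∑' n, stripTerm d w n z

theorem norm_stripKernel_le (hw : w ∈ slab (Ioo 0 d)) {z : Octonion} (hz : z ∈ slab (Icc 0 d)) :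
    ‖stripKernel d z w‖ ≤
      ((∑' n : ℤ, ((|(n : ℝ)| + 1) ^ 2)⁻¹) * stripConst d w) * decay (im z - im w) := by
  rw [mul_assoc]
  exact tsum_of_norm_bounded (summable_inv_abs_add_one_sq.hasSum.mul_right _)
    (norm_stripTerm_le hw hz)

theorem hasFDerivAt_stripTerm (hw : w ∈ slab (Ioo 0 d)) {z : Octonion} (hz : z ∈ slab (Icc 0 d))
    (n : ℤ) : HasFDerivAt (stripTerm d w n)
      ((-1 : ℝ) ^ n • cauchyKernelFDeriv (z + conj w + (2 * d * n) • e 0)) z := by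
  have hne := strip_ne_zero hw hz n
  have h := (hasFDerivAt_cauchyKernel_add (z := z) (v := conj w + (2 * d * n) • e 0)
    (by rwa [← add_assoc])).const_smul ((-1 : ℝ) ^ n)
  simp only [← add_assoc] at h
  exact h

theorem continuousOn_stripKernel (hw : w ∈ slab (Ioo 0 d)) :
    ContinuousOn (fun z => stripKernel d z w) (slab (Icc 0 d)) :=
  continuousOn_tsum (fun n _ hz => (hasFDerivAt_stripTerm hw hz n).continuousAt.continuousWithinAt)
    (summable_inv_abs_add_one_sq.mul_right (stripConst d w))
    fun n _ hz => norm_stripTerm_le_const hw hz n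

/-- The derivative decays with exponent 8 in n; weakening it to 2 reuses the same summable majorant.
-/
theorem norm_fderiv_stripTerm_le (hw : w ∈ slab (Ioo 0 d)) {z : Octonion}
    (hz : z ∈ slab (Icc 0 d)) (n : ℤ) :
    ‖(-1 : ℝ) ^ n • cauchyKernelFDeriv (z + conj w + (2 * d * n) • e 0)‖ ≤
      ((|(n : ℝ)| + 1) ^ 2)⁻¹ * (9 * (gap d w ^ 8)⁻¹) := by
  have hg := gap_pos hw
  have h1 : (1 : ℝ) ≤ |(n : ℝ)| + 1 := by linarith [abs_nonneg (n : ℝ)]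
  rw [norm_smul, Real.norm_eq_abs, abs_neg_one_zpow, one_mul]
  refine (norm_fderiv_cauchyKernel_le (strip_ne_zero hw hz n)).trans ?_
  have h2 : gap d w * (|(n : ℝ)| + 1) ≤ ‖z + conj w + (2 * d * n) • e 0‖ :=
    (gap_mul_le hw hz n).trans (abs_re_le_norm _)
  calc _ ≤ 9 * ((gap d w * (|(n : ℝ)| + 1)) ^ 8)⁻¹ := by gcongr
    _ = ((|(n : ℝ)| + 1) ^ 8)⁻¹ * (9 * (gap d w ^ 8)⁻¹) := by
        rw [mul_pow, mul_inv]
        ring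
    _ ≤ _ := by
        gcongr ?_⁻¹ * _
        exact pow_le_pow_right₀ h1 (by norm_num)

theorem hasFDerivAt_stripKernel (hw : w ∈ slab (Ioo 0 d)) {z : Octonion}
    (hz : z ∈ slab (Ioo 0 d)) : HasFDerivAt (fun z => stripKernel d z w)
      (∑' n : ℤ, (-1 : ℝ) ^ n • cauchyKernelFDeriv (z + conj w + (2 * d * n) • e 0)) z := by
  have hsub : slab (Ioo 0 d) ⊆ slab (Icc 0 d) := fun z hz => Ioo_subset_Icc_self hz
  have hconv : Convex ℝ (slab (Ioo 0 d)) :=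
    (convex_Ioo 0 d).linear_preimage (EuclideanSpace.proj (𝕜 := ℝ) (0 : Fin 8)).toLinearMap
  exact hasFDerivAt_tsum_of_isPreconnected
    (f' := fun (n : ℤ) z => (-1 : ℝ) ^ n • cauchyKernelFDeriv (z + conj w + (2 * d * n) • e 0))
    (summable_inv_abs_add_one_sq.mul_right (9 * (gap d w ^ 8)⁻¹)) (isOpen_slab isOpen_Ioo)
    hconv.isPreconnected (fun n z hz => hasFDerivAt_stripTerm hw (hsub hz) n)
    (fun n z hz => norm_fderiv_stripTerm_le hw (hsub hz) n) hz (summable_stripTerm hw (hsub hz)) hz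

/-- The linear map `A ↦ ∑ e_i A(e_i)` on derivatives. -/
def cauchyRiemannL : (Octonion →L[ℝ] Octonion) →L[ℝ] Octonion :=
  ∑ i, (mulL (e i)).comp (ContinuousLinearMap.apply ℝ Octonion (e i))

theorem cauchyRiemannL_apply (A : Octonion →L[ℝ] Octonion) :
    cauchyRiemannL A = ∑ i, e i * A (e i) := by
  simp [cauchyRiemannL, mulL_apply]

/-- The Cauchy–Riemann operator is continuous and linear in the derivative, so it passes through the
series and kills each term. -/
theorem leftRegularOn_stripKernel (hw : w ∈ slab (Ioo 0 d)) :
    LeftRegularOn (fun z => stripKernel d z w) (slab (Ioo 0 d)) := by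
  refine ⟨fun z hz => (hasFDerivAt_stripKernel hw hz).differentiableAt.differentiableWithinAt,
    fun z hz => ?_⟩
  have hz' : z ∈ slab (Icc 0 d) := Ioo_subset_Icc_self hz
  rw [cauchyRiemann_eq (hasFDerivAt_stripKernel hw hz), ← cauchyRiemannL_apply,
    ContinuousLinearMap.map_tsum]
  · convert! tsum_zero with n
    rw [map_smul, cauchyRiemannL_apply, cauchyKernelFDeriv,
      sum_mul_fderiv_cauchyKernel (strip_ne_zero hw hz' n), smul_zero]
  · exact Summable.of_norm_bounded (summable_inv_abs_add_one_sq.mul_right _)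
      (norm_fderiv_stripTerm_le hw hz')

/-- Termwise integration of the strip kernel over a hyperplane of the closed strip. -/
theorem hasSum_integral_stripKernel (hw : w ∈ slab (Ioo 0 d)) {t : ℝ} (ht : t ∈ Icc 0 d)
    {φ : Octonion → Octonion} (hφ : MemLp (fun x => φ (point t x)) 2 volume) :
    HasSum (fun n : ℤ => -((-1 : ℝ) ^ n • cauchyPairing (w + (2 * d * n + 2 * t) • e 0) φ t))
      (∫ x, conj (stripKernel d (point t x) w) * φ (point t x)) := by
  have hpt (x : Imaginary) : point t x ∈ slab (Icc 0 d) := ht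
  have hterm (n : ℤ) (x : Imaginary) : conj (stripTerm d w n (point t x)) * φ (point t x) =
      -((-1 : ℝ) ^ n • (cauchyKernel (point t x - (w + (2 * d * n + 2 * t) • e 0)) *
        φ (point t x))) := by
    rw [stripTerm, conj_smul, conj_cauchyKernel_point, Octonion.smul_mul, Octonion.neg_mul,
      smul_neg]
  have hbound (n : ℤ) (x : Imaginary) : ‖conj (stripTerm d w n (point t x))‖ ≤
      (((|(n : ℝ)| + 1) ^ 2)⁻¹ * stripConst d w) * decay (x - im w) := by
    rw [norm_conj, mul_assoc]
    exact norm_stripTerm_le hw (hpt x) n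
  have hmeas (n : ℤ) :
      AEStronglyMeasurable (fun x => conj (stripTerm d w n (point t x))) volume := by
    refine (conjL.continuous.comp (continuous_iff_continuousAt.2 fun x => ?_)).aestronglyMeasurable
    exact (hasFDerivAt_stripTerm hw (hpt x) n).continuousAt.comp
      (continuous_point_right t).continuousAt
  have hint (n : ℤ) := integrable_mul_of_decay (hmeas n) (hbound n) hφ
  -- Summability of the L¹ norms is what allows sum and integral to be exchanged.
  have hsum : Summable fun n : ℤ => ∫ x, ‖conj (stripTerm d w n (point t x)) * φ (point t x)‖ := by
    refine Summable.of_nonneg_of_le (fun n => integral_nonneg fun x => norm_nonneg _) (fun n => ?_)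
      (summable_inv_abs_add_one_sq.mul_right
        (stripConst d w * ∫ x, decay (x - im w) * ‖φ (point t x)‖))
    rw [← mul_assoc, ← integral_const_mul]
    refine integral_mono (hint n).norm ((integrable_decay_mul hφ _).const_mul _) fun x => ?_
    simp only [Octonion.norm_mul]
    rw [← mul_assoc (_ * stripConst d w)]
    gcongr
    exact hbound n x
  have h := hasSum_integral_of_summable_integral_norm hint hsum
  have htsum (x : Imaginary) : ∑' n, conj (stripTerm d w n (point t x)) * φ (point t x) =
      conj (stripKernel d (point t x) w) * φ (point t x) :=
    (ContinuousLinearMap.map_tsum ((mulL.flip (φ (point t x))).comp conjL)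
      (summable_stripTerm hw (hpt x))).symm
  simp only [htsum] at h
  have hfun (n : ℤ) : ∫ x, conj (stripTerm d w n (point t x)) * φ (point t x) =
      -((-1 : ℝ) ^ n • cauchyPairing (w + (2 * d * n + 2 * t) • e 0) φ t) := by
    simp only [hterm]
    rw [integral_neg, integral_smul, cauchyPairing]
  simp only [hfun] at h
  exact h

/-- This is where the period 2d and the alternating signs are needed: they match each term on one
face with its neighbour on the other, giving a two-face Cauchy integral with a common pole. -/
theorem strip_rep {f φ : Octonion → Octonion} (hf : MemHardy (Ioo 0 d) f)
    (hφ : HasBoundaryValue (Ioo 0 d) f φ) (hw : w ∈ slab (Ioo 0 d)) :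
    f w = (3 / π ^ 4) • ∑' t : frontier (Ioo 0 d),
      ∫ x, conj (stripKernel d (point t x) w) * φ (point t x) := by
  have hd : 0 < d := hw.1.trans hw.2
  have h0 := hasSum_integral_stripKernel hw (left_mem_Icc.2 hd.le)
    (hφ 0 (left_mem_frontier_Ioo hd)).1
  have h1 := hasSum_integral_stripKernel hw (right_mem_Icc.2 hd.le)
    (hφ d (right_mem_frontier_Ioo hd)).1
  have h1' : HasSum (fun n : ℤ => (-1 : ℝ) ^ n • cauchyPairing (w + (2 * d * n) • e 0) φ d)
      (∫ x, conj (stripKernel d (point d x) w) * φ (point d x)) := by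
    -- On Re z = d the pole of term n is w + 2d(n+1); reindexing by one aligns it with the face Re z
    -- = 0 and turns the minus sign into a plus.
    rw [← (Equiv.addRight (1 : ℤ)).hasSum_iff]
    refine h1.congr_fun ?_
    intro n
    simp only [Function.comp_apply, Equiv.coe_addRight]
    rw [zpow_add₀ (by norm_num), zpow_one, mul_neg_one, neg_smul]
    push_cast
    ring_nf
  have hsum := h0.add h1'
  have hval : HasSum (fun n : ℤ => -((-1 : ℝ) ^ n •
      cauchyPairing (w + (2 * d * n + 2 * 0) • e 0) φ 0) +
        (-1 : ℝ) ^ n • cauchyPairing (w + (2 * d * n) • e 0) φ d) ((π ^ 4 / 3) • f w) := by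
    -- A shift of Re w by a nonzero multiple of 2d leaves the closed strip, so the Cauchy integral
    -- vanishes.
    have hn0 : ∀ n : ℤ, n ≠ 0 → -((-1 : ℝ) ^ n •
        cauchyPairing (w + (2 * d * n + 2 * 0) • e 0) φ 0) +
          (-1 : ℝ) ^ n • cauchyPairing (w + (2 * d * n) • e 0) φ d = 0 := by
      intro n hn
      rw [neg_add_eq_sub, mul_zero, add_zero, ← smul_sub, hf.cauchy_strip_eq_zero hd hφ, smul_zero]
      have hre : (w + (2 * d * n) • e 0) 0 = w 0 + 2 * d * n := by simp [e]
      rw [hre]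
      intro hmem
      rcases lt_or_gt_of_ne hn with hlt | hgt
      · have : (n : ℝ) ≤ -1 := by exact_mod_cast (by omega : n ≤ -1)
        nlinarith [hmem.1, hw.2]
      · have : (1 : ℝ) ≤ n := by exact_mod_cast (by omega : 1 ≤ n)
        nlinarith [hmem.2, hw.1]
    have := hasSum_single 0 hn0
    simp only [Int.cast_zero, mul_zero, add_zero, zero_smul, zpow_zero, one_smul,
      neg_add_eq_sub] at this ⊢
    rw [hf.cauchy_strip hd hφ hw] at this
    exact this
  have hfr : frontier (Ioo 0 d) = (({0, d} : Finset ℝ) : Set ℝ) := by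
    simp [frontier_Ioo hd]
  rw [hfr, Finset.tsum_subtype' {0, d}
    (fun t : ℝ => ∫ x, conj (stripKernel d (point t x) w) * φ (point t x)),
    Finset.sum_pair hd.ne, hsum.unique hval, smul_smul]
  have : 3 / π ^ 4 * (π ^ 4 / 3) = 1 := by field_simp
  rw [this, one_smul]

end Strip

theorem isSzegoKernel_strip {d : ℝ} (hd : 0 < d) : IsSzegoKernel (Ioo 0 d) (stripKernel d) := by
  have hfin : (frontier (Ioo 0 d)).Finite := by simp [frontier_Ioo hd]
  have hcl : closure (Ioo 0 d) = Icc 0 d := closure_Ioo hd.ne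
  refine isSzegoKernel_of_dominated isOpen_Ioo hfin (fun w hw => leftRegularOn_stripKernel hw)
    (fun w hw => hcl ▸ continuousOn_stripKernel hw) (fun w hw => ⟨_, ?_, fun z hz =>
      norm_stripKernel_le hw (hcl ▸ hz)⟩) fun w hw f φ hf hφ => strip_rep hf hφ hw
  exact mul_nonneg (tsum_nonneg fun n => by positivity) (stripConst_nonneg hw)

/-! ### The limit of infinite thickness. -/

/-- Once d ≥ Re z + Re w, the argument of each term with n ≠ 0 has norm at least d|n|. Such terms
tend to zero under a majorant independent of d, while the term n = 0 is the half-space kernel for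
every d. -/
theorem tendsto_stripKernel {z w : Octonion} (hz : 0 < z 0) (hw : 0 < w 0) :
    Tendsto (fun d => stripKernel d z w) atTop (𝓝 (cauchyKernel (z + conj w))) := by
  have hbig : ∀ᶠ d : ℝ in atTop, 1 ≤ d ∧ z 0 + w 0 ≤ d :=
    (eventually_ge_atTop 1).and (eventually_ge_atTop _)
  have hnorm {d : ℝ} (hd : 1 ≤ d ∧ z 0 + w 0 ≤ d) {n : ℤ} (hn : n ≠ 0) :
      d * |(n : ℝ)| ≤ ‖z + conj w + (2 * d * n) • e 0‖ ∧ (1 : ℝ) ≤ |(n : ℝ)| := by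
    have hn1 : (1 : ℝ) ≤ |(n : ℝ)| := by exact_mod_cast Int.one_le_abs hn
    refine ⟨le_trans ?_ (abs_re_le_norm _), hn1⟩
    rw [re_add_conj_add]
    have h1 : |2 * d * (n : ℝ)| = 2 * d * |(n : ℝ)| := by
      rw [abs_mul, abs_of_nonneg (by linarith)]
    have h2 := abs_sub_abs_le_abs_sub (2 * d * (n : ℝ)) (-(z 0 + w 0))
    rw [abs_neg, abs_of_pos (add_pos hz hw), h1] at h2
    have h3 : 2 * d * (n : ℝ) - -(z 0 + w 0) = z 0 + w 0 + 2 * d * n := by ring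
    rw [h3] at h2
    nlinarith
  have hlim := tendsto_tsum_of_dominated_convergence (𝓕 := atTop)
    (f := fun (d : ℝ) (n : ℤ) => stripTerm d w n z)
    (g := fun n : ℤ => if n = 0 then cauchyKernel (z + conj w) else 0)
    -- The norm covers n = 0; the 4 covers n ≠ 0, where |n| ≥ (|n| + 1)/2.
    (bound := fun n : ℤ => ((|(n : ℝ)| + 1) ^ 2)⁻¹ * (‖cauchyKernel (z + conj w)‖ + 4))
    (summable_inv_abs_add_one_sq.mul_right _) (fun n => ?_) ?_
  · rwa [tsum_ite_eq] at hlim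
  · by_cases hn : n = 0
    · subst hn
      simp [stripTerm]
    · rw [if_neg hn]
      refine squeeze_zero_norm' ?_ tendsto_inv_atTop_zero
      filter_upwards [hbig] with d hd
      obtain ⟨h1, h2⟩ := hnorm hd hn
      have hd0 : 0 < d := by linarith [hd.1]
      rw [norm_stripTerm, norm_cauchyKernel]
      have h3 : d ≤ ‖z + conj w + (2 * d * n) • e 0‖ := by nlinarith
      refine inv_anti₀ hd0 (h3.trans ?_)
      exact le_self_pow₀ (hd.1.trans h3) (by norm_num)
  · filter_upwards [hbig] with d hd n
    by_cases hn : n = 0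
    · subst hn
      simp [stripTerm]
    · obtain ⟨h1, h2⟩ := hnorm hd hn
      rw [norm_stripTerm]
      have hu : (|(n : ℝ)| + 1) / 2 ≤ ‖z + conj w + (2 * d * n) • e 0‖ := by nlinarith [hd.1]
      have hu1 : 1 ≤ ‖z + conj w + (2 * d * n) • e 0‖ := by nlinarith [hd.1]
      rw [norm_cauchyKernel]
      calc _ ≤ (‖z + conj w + (2 * d * n) • e 0‖ ^ 2)⁻¹ := by
            refine inv_anti₀ (by positivity) (pow_le_pow_right₀ hu1 (by norm_num))
        _ ≤ (((|(n : ℝ)| + 1) / 2) ^ 2)⁻¹ := by gcongr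
        _ = ((|(n : ℝ)| + 1) ^ 2)⁻¹ * 4 := by
            rw [div_pow, inv_div]
            ring
        _ ≤ _ := by
            gcongr
            linarith [norm_nonneg (cauchyKernel (z + conj w))]

end Octonion

end

theorem mainTheorem2 :
    (∀ K : Octonion → Octonion → Octonion,
      Octonion.IsSzegoKernel (Ioi 0) K ↔
        ∀ z ∈ Octonion.slab (Ioi 0), ∀ w ∈ Octonion.slab (Ioi 0),
          K z w = (‖Octonion.conj z + w‖ ^ 8)⁻¹ • (Octonion.conj z + w)) ∧
    (∀ d : ℝ, 0 < d → ∀ K : Octonion → Octonion → Octonion,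
      Octonion.IsSzegoKernel (Ioo 0 d) K ↔
        ∀ z ∈ Octonion.slab (Ioo 0 d), ∀ w ∈ Octonion.slab (Ioo 0 d),
          HasSum (fun n : ℤ =>
            ((-1 : ℝ) ^ n * (‖Octonion.conj z + w + (2 * d * n) • Octonion.e 0‖ ^ 8)⁻¹) •
              (Octonion.conj z + w + (2 * d * n) • Octonion.e 0)) (K z w)) ∧
    (∀ K : ℝ → Octonion → Octonion → Octonion,
      (∀ d : ℝ, 0 < d → Octonion.IsSzegoKernel (Ioo 0 d) (K d)) →
        ∀ z ∈ Octonion.slab (Ioi 0), ∀ w ∈ Octonion.slab (Ioi 0),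
          Tendsto (fun d : ℝ => K d z w) atTop
            (𝓝 ((‖Octonion.conj z + w‖ ^ 8)⁻¹ • (Octonion.conj z + w)))) := by
  have hform (z w : Octonion) : (‖Octonion.conj z + w‖ ^ 8)⁻¹ • (Octonion.conj z + w) =
      Octonion.cauchyKernel (z + Octonion.conj w) :=
    Octonion.cauchyKernel_eq_of_conj (by rw [Octonion.conj_add, Octonion.conj_conj])
  have hfin (d : ℝ) (hd : 0 < d) : (frontier (Ioo 0 d)).Finite := by simp [frontier_Ioo hd]
  have hstrip (d : ℝ) (hd : 0 < d) := Octonion.isSzegoKernel_iff isOpen_Ioo (hfin d hd)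
    (Octonion.isSzegoKernel_strip hd)
  refine ⟨fun K => ?_, fun d hd K => ?_, fun K hK z hz w hw => ?_⟩
  · simp only [hform]
    exact Octonion.isSzegoKernel_iff isOpen_Ioi Octonion.finite_frontier_Ioi
      Octonion.isSzegoKernel_halfSpace K
  · rw [hstrip d hd K]
    refine forall₄_congr fun z hz w hw => ?_
    simp only [← Octonion.stripTerm_eq]
    rw [(Octonion.summable_stripTerm hw (Ioo_subset_Icc_self hz)).hasSum_iff]
    exact eq_comm
  · rw [hform]
    refine (Octonion.tendsto_stripKernel hz hw).congr' ?_
    -- The kernel is determined only on the strip, so d must exceed both real parts.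
    filter_upwards [eventually_gt_atTop (z 0), eventually_gt_atTop (w 0)] with d hdz hdw
    have hd : 0 < d := lt_trans hz hdz
    exact ((hstrip d hd (K d)).1 (hK d hd) z ⟨hz, hdz⟩ w ⟨hw, hdw⟩).symm
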